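/- Let $T\subset\mathbb R$ be an interval and let $K:T\times T\to\mathbb R$, $K(s,t)=\tilde K(t-s)$ with $\tilde K:\mathbb R\to\mathbb R$, be a continuous stationary positive semi-definite kernel with $\tilde K(0)=1$. Let $P$ be the centered Gaussian measure on $\mathbb R^T$ with covariance function $K$, and set $L(h)=h^{-1}(1-\tilde K(h))$ for $h>0$. Notation. For a probability measure $Q$ on $\mathbb R^T$ and times $t_0,\dots,t_n\in T$, $Q^{t_0,\dots,t_n}$ is the law of the coordinates at these times, and for $u<v$ in $T$, $k_Q^{u,v}$ is the probability kernel with $Q^{u,v}(dx,dy)=Q^u(dx)\,k_Q^{u,v}(x,dy)$. For $t_0<\dots<t_n$, the concatenation of $Q^{t_0,t_1},\dots,Q^{t_{n-1},t_n}$ is the probability measure $Q^{t_0}(dx_0)\,k_Q^{t_0,t_1}(x_0,dx_1)\cdots k_Q^{t_{n-1},t_n}(x_{n-1},dx_n)$ on $\mathbb R^{n+1}$. $Q$ is a Markov measure if $Q^{t_0,\dots,t_n}$ is equal to this concatenation for all $t_0<\dots<t_n$ in $T$. A partition of $[s,t]$ is a finite sequence $R=(s=t_0<t_1<\dots<t_n=t)$,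 with mesh $\sigma_R=\max_i|t_{i+1}-t_i|$; $P^{s,t}_{\{R\}}$ is the law of the first and last coordinates under the concatenation of $P^{t_0,t_1},\dots,P^{t_{n-1},t_n}$. A Markov measure $P'$ on $\mathbb R^T$ is a strong local Markov transform of $P$ if, for all $s<t$ in $T$ and every sequence $(R_n)$ of partitions of $[s,t]$ with $\sigma_{R_n}\to0$, $P^{s,t}_{\{R_n\}}\to P'^{s,t}$ weakly; it is a weak local Markov transform of $P$ if, for all $s<t$ in $T$, there is a sequence $(R_n)$ of partitions of $[s,t]$ with $\sigma_{R_n}\to0$ and $P^{s,t}_{\{R_n\}}\to P'^{s,t}$ weakly. For every $\alpha\in[0,\infty]$ there is a unique centered Gaussian measure $P_\alpha$ on $\mathbb R^T$ with covariance function $K_\alpha(s,t)=\exp(-\alpha|t-s|)$ (where $\infty\cdot0=0$ and $\exp(-\infty)=0$), and the following hold. 1. If $\lim_{h\to0^+}L(h)=\alpha$, then $P_\alpha$ is a strong local Markov transform of $P$; if $T$ has more than one point, it is the only one. 2. For every sequence $(s_n)_{n\ge1}$ of positive numbers with $s_n\to0$ and $L(s_n)\to\alpha$, and all $s<t$ in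 $T$, the partitions $R_n^{s,t}=\big(s_n\mathbb Z\cap(s,t)\big)\cup\{s,t\}$ satisfy $P^{s,t}_{\{R_n^{s,t}\}}\to P_\alpha^{s,t}$ weakly. In particular, if $\alpha$ is a cluster point of $L$ at $0^+$, then $P_\alpha$ is a weak local Markov transform of $P$. -/

import Mathlib

open MeasureTheory ProbabilityTheory Filter Topology
open scoped ENNReal

noncomputable section

namespace LocalMarkov

/-! ### Two-dimensional laws, concatenation and composition of transport plans -/

/-- Law `P^t` of the coordinate at time `t`. -/
def law₁ {T : Set ℝ} (P : ProbabilityMeasure (T → ℝ)) (t : T) : ProbabilityMeasure ℝ :=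
  P.map (f := fun x : T → ℝ => x t) (measurable_pi_apply t).aemeasurable

/-- Joint law `P^{s,t}` of the coordinates at times `s` and `t`. -/
def law₂ {T : Set ℝ} (P : ProbabilityMeasure (T → ℝ)) (s t : T) : ProbabilityMeasure (ℝ × ℝ) :=
  P.map (f := fun x : T → ℝ => (x s, x t))
    ((measurable_pi_apply s).prodMk (measurable_pi_apply t)).aemeasurable

/-- Joint law `P^{t_0,…,t_n}` of the coordinates at times `t_0, …, t_n`. -/
def lawFin {T : Set ℝ} (P : ProbabilityMeasure (T → ℝ)) {n : ℕ} (t : Fin (n + 1) → T) :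
    ProbabilityMeasure (Fin (n + 1) → ℝ) :=
  P.map (f := fun (x : T → ℝ) (i : Fin (n + 1)) => x (t i))
    (measurable_pi_lambda _ fun i => measurable_pi_apply (t i)).aemeasurable

theorem measurable_snoc (n : ℕ) :
    Measurable (fun p : (Fin (n + 1) → ℝ) × ℝ =>
      (Fin.snoc p.1 p.2 : Fin (n + 2) → ℝ)) := by
  refine measurable_pi_lambda _ fun i => ?_
  refine Fin.lastCases ?_ (fun j => ?_) i
  · simpa using measurable_snd
  · simpa using measurable_fst.eval (a := j)

/-- Concatenation `Q_1 ∘ ⋯ ∘ Q_n`, the law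
`μ(dx_0) k_1(x_0, dx_1) ⋯ k_n(x_{n-1}, dx_n)` on `ℝ^{n+1}`, where `μ` is the first marginal of the
first plan and `k_i` is the disintegration kernel of `Q_i` with respect to its first marginal.
(The initial law `μ` is an argument so that the concatenation of no plan at all makes sense.) -/
def concat (μ : ProbabilityMeasure ℝ) :
    (n : ℕ) → (Fin n → ProbabilityMeasure (ℝ × ℝ)) → ProbabilityMeasure (Fin (n + 1) → ℝ)
  | 0, _ => μ.map (f := fun (x : ℝ) (_ : Fin 1) => x)
      (measurable_pi_lambda _ fun _ => measurable_id).aemeasurable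
  | n + 1, Q =>
      ⟨((concat μ n fun i => Q i.castSucc : Measure (Fin (n + 1) → ℝ)) ⊗ₘ
          ((Q (Fin.last n) : Measure (ℝ × ℝ)).condKernel.comap
            (fun x : Fin (n + 1) → ℝ => x (Fin.last n)) (measurable_pi_apply _))).map
          (fun p => (Fin.snoc p.1 p.2 : Fin (n + 2) → ℝ)),
        Measure.isProbabilityMeasure_map (measurable_snoc n).aemeasurable⟩

/-- `P` is a Markov measure: its law at times `t_0 < ⋯ < t_n` is the concatenation of its
two-dimensional laws at consecutive times. -/
def IsMarkovMeasure {T : Set ℝ} (P : ProbabilityMeasure (T → ℝ)) : Prop :=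
  ∀ (n : ℕ) (t : Fin (n + 1) → T), StrictMono t →
    lawFin P t = concat (law₁ P (t 0)) n fun i => law₂ P (t i.castSucc) (t i.succ)

/-! ### Partitions -/

/-- A partition `s = t_0 < t_1 < ⋯ < t_size = t` of `[s, t]`. -/
structure Partition {T : Set ℝ} (s t : T) where
  size : ℕ
  pts : Fin (size + 1) → T
  strictMono : StrictMono pts
  pts_zero : pts 0 = s
  pts_last : pts (Fin.last size) = t

/-- The mesh `max_i |t_{i+1} - t_i|` of a partition. -/
def Partition.mesh {T : Set ℝ} {s t : T} (R : Partition s t) : ℝ :=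
  ⨆ i : Fin R.size, |(R.pts i.succ : ℝ) - (R.pts i.castSucc : ℝ)|

/-- The composition `P^{s,t}_{R} = P^{t_0,t_1} · ⋯ · P^{t_{n-1},t_n}` along a partition `R` of
`[s, t]`: the law of the first and last coordinates under the concatenation. -/
def compose {T : Set ℝ} (P : ProbabilityMeasure (T → ℝ)) {s t : T} (R : Partition s t) :
    ProbabilityMeasure (ℝ × ℝ) :=
  (concat (law₁ P (R.pts 0)) R.size fun i => law₂ P (R.pts i.castSucc) (R.pts i.succ)).map
    (f := fun x : Fin (R.size + 1) → ℝ => (x 0, x (Fin.last R.size)))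
    ((measurable_pi_apply _).prodMk (measurable_pi_apply _)).aemeasurable

/-- The set `(δℤ ∩ (s, t)) ∪ {s, t}`, for times in `T`. -/
def gridSet {T : Set ℝ} (δ : ℝ) (s t : T) : Set T :=
  {u : T | (s < u ∧ u < t) ∧ ∃ k : ℤ, (u : ℝ) = δ * k} ∪ {s, t}

theorem gridSet_finite {T : Set ℝ} {δ : ℝ} (hδ : 0 < δ) (s t : T) : (gridSet δ s t).Finite := by
  refine Set.Finite.union ?_ (by simp)
  have h : ((fun k : ℤ => δ * (k : ℝ)) '' Set.Icc ⌊(s : ℝ) / δ⌋ ⌈(t : ℝ) / δ⌉).Finite :=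
    (Set.finite_Icc _ _).image _
  refine (h.preimage (f := fun u : T => (u : ℝ)) Subtype.val_injective.injOn).subset ?_
  rintro u ⟨⟨hsu, hut⟩, k, hk⟩
  have h1 : (s : ℝ) < δ * k := hk ▸ hsu
  have h2 : δ * k < (t : ℝ) := hk ▸ hut
  refine ⟨k, ⟨?_, ?_⟩, hk.symm⟩
  · have : (s : ℝ) / δ < k := by rw [div_lt_iff₀ hδ]; linarith
    exact_mod_cast ((Int.floor_le _).trans this.le)
  · have : (k : ℝ) < (t : ℝ) / δ := by rw [lt_div_iff₀ hδ]; linarith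
    exact_mod_cast (this.le.trans (Int.le_ceil _))

/-- The grid partition of `[s, t]`: the increasing enumeration of `(δℤ ∩ (s, t)) ∪ {s, t}`. -/
def gridPartition {T : Set ℝ} {δ : ℝ} (hδ : 0 < δ) {s t : T} (hst : s < t) : Partition s t :=
  let F : Finset T := (gridSet_finite hδ s t).toFinset
  have hs : s ∈ F := by simp [F, gridSet]
  have ht : t ∈ F := by simp [F, gridSet]
  have hF : ∀ u ∈ F, s ≤ u ∧ u ≤ t := by
    intro u hu
    simp only [F, Set.Finite.mem_toFinset, gridSet] at hu
    rcases hu with ⟨⟨h1, h2⟩, -⟩ | rfl | rfl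
    · exact ⟨h1.le, h2.le⟩
    · exact ⟨le_rfl, hst.le⟩
    · exact ⟨hst.le, le_rfl⟩
  have hc : F.card = (F.card - 1) + 1 := (Nat.succ_pred_eq_of_pos (Finset.card_pos.2 ⟨s, hs⟩)).symm
  { size := F.card - 1
    pts := F.orderEmbOfFin hc
    strictMono := (F.orderEmbOfFin hc).strictMono
    pts_zero := le_antisymm
      (by
        obtain ⟨i, hi⟩ : s ∈ Set.range (F.orderEmbOfFin hc) := by simpa using hs
        exact ((F.orderEmbOfFin hc).monotone (Fin.zero_le i)).trans hi.le)
      (hF _ (F.orderEmbOfFin_mem hc _)).1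
    pts_last := le_antisymm (hF _ (F.orderEmbOfFin_mem hc _)).2
      (by
        obtain ⟨i, hi⟩ : t ∈ Set.range (F.orderEmbOfFin hc) := by simpa using ht
        exact hi.ge.trans ((F.orderEmbOfFin hc).monotone (Fin.le_last i))) }

/-! ### Local Markov transforms -/

/-- `P'` is a weak local Markov transform of `P`. -/
def IsWeakLocalMarkovTransform {T : Set ℝ} (P P' : ProbabilityMeasure (T → ℝ)) : Prop :=
  IsMarkovMeasure P' ∧
    ∀ s t : T, s < t → ∃ R : ℕ → Partition s t,
      Tendsto (fun n => compose P (R n)) atTop (𝓝 (law₂ P' s t)) ∧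
        Tendsto (fun n => (R n).mesh) atTop (𝓝 0)

/-- `P'` is a strong local Markov transform of `P`. -/
def IsStrongLocalMarkovTransform {T : Set ℝ} (P P' : ProbabilityMeasure (T → ℝ)) : Prop :=
  IsMarkovMeasure P' ∧
    ∀ s t : T, s < t → ∀ R : ℕ → Partition s t,
      Tendsto (fun n => (R n).mesh) atTop (𝓝 0) →
        Tendsto (fun n => compose P (R n)) atTop (𝓝 (law₂ P' s t))

/-! ### Kernels and Gaussian measures -/

/-- Positive semi-definite (symmetric, real) kernels. -/
def IsPosSemidefKernel {T : Set ℝ} (K : T → T → ℝ) : Prop :=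
  ∀ (m : ℕ) (t : Fin m → T), (Matrix.of fun i j => K (t i) (t j)).PosSemidef

/-- `P` is a centered Gaussian measure on `ℝ^T` with covariance function `K`. -/
structure IsCenteredGaussian {T : Set ℝ} (K : T → T → ℝ) (P : ProbabilityMeasure (T → ℝ)) :
    Prop where
  gaussian : IsGaussianProcess (fun (t : T) (x : T → ℝ) => x t) (P : Measure (T → ℝ))
  centered : ∀ t : T, ∫ x, x t ∂(P : Measure (T → ℝ)) = 0
  covariance : ∀ s t : T,
    cov[fun x : T → ℝ => x s, fun x : T → ℝ => x t; (P : Measure (T → ℝ))] = K s t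

/-- The kernel `K_α(s, t) = exp(-α |t - s|)` for a constant `α ∈ [0, ∞]`, with the conventions
`∞ · 0 = 0` and `exp(-∞) = 0`; so `K_∞(s, t)` is `1` if `s = t` and `0` otherwise. -/
def expKernel (T : Set ℝ) (α : ℝ≥0∞) (s t : T) : ℝ :=
  (EReal.exp (-((α * ENNReal.ofReal |(t : ℝ) - (s : ℝ)| : ℝ≥0∞) : EReal))).toReal

/-- The decay rate `L(h) = h⁻¹ (1 - K̃(h))`, as an extended real number. -/
def decayRate (Kt : ℝ → ℝ) (h : ℝ) : EReal := ((h⁻¹ * (1 - Kt h) : ℝ) : EReal)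

end LocalMarkov

end

/-! All one-dimensional laws of `P` are standard normal, so a two-dimensional law is determined by
its correlation `ρ`, and its disintegration kernel is `x ↦ N(ρ x, 1 - ρ²)`. Composing two such
kernels multiplies the correlations (`gaussianTransition_comp`). Hence the composition of `P` along
a partition with increments `h_i` is the Gaussian pair with correlation `∏ K̃(h_i)`
(`IsCenteredGaussian.compose_eq`). Gaussian pairs depend weakly continuously on the correlation
(`tendsto_gaussianPair`), so only this product of real numbers has to be studied.

Since `1 - K̃(h) = h L(h)` and `K̃(h) → 1` as `h → 0⁺`, the product behaves like `exp(-∑ h_i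
L(h_i))`, with `∑ h_i = t - s`. If `L → α`, the sum tends to `α (t - s)` for every sequence of
partitions with vanishing mesh. Along the grids of step `δ_n` it suffices that `L(δ_n) → α`: all
increments but the first and the last equal `δ_n`, and these two contribute `1 - K̃ → 0`.

The measure `P_α` is built from an isonormal process and an explicit Hilbert space feature map for
`K_α`. It is Markov because `K_α(r, t) = K_α(r, s) K_α(s, t)` for `r ≤ s ≤ t`, which makes the
residual at a new time independent of the past. Uniqueness of the strong transform holds because the
two-dimensional laws are forced as weak limits and determine a Markov measure. -/

noncomputable section

namespace LocalMarkov

/-! ### Gaussian transition kernels -/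

/-- The Gaussian transition kernel `x ↦ N(ρ x, 1 - ρ²)`. -/
def gaussianTransition (ρ : ℝ) : Kernel ℝ ℝ where
  toFun x := gaussianReal (ρ * x) (1 - ρ ^ 2).toNNReal
  measurable' := by
    have h : Measurable fun x : ℝ => (ρ * x, (1 - ρ ^ 2).toNNReal) := by fun_prop
    exact measurable_gaussianReal.comp h

theorem gaussianTransition_apply (ρ x : ℝ) :
    gaussianTransition ρ x = gaussianReal (ρ * x) (1 - ρ ^ 2).toNNReal := rfl

instance instIsMarkovKernelGaussianTransition (ρ : ℝ) : IsMarkovKernel (gaussianTransition ρ) :=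
  ⟨fun x => by rw [gaussianTransition_apply]; infer_instance⟩

theorem lintegral_gaussianTransition (ρ x : ℝ) {f : ℝ → ℝ≥0∞} (hf : Measurable f) :
    ∫⁻ y, f y ∂gaussianTransition ρ x
      = ∫⁻ z, f (ρ * x + z) ∂gaussianReal 0 (1 - ρ ^ 2).toNNReal := by
  have h : gaussianTransition ρ x
      = (gaussianReal 0 (1 - ρ ^ 2).toNNReal).map (ρ * x + ·) := by
    rw [gaussianReal_map_const_add, zero_add, gaussianTransition_apply]
  rw [h, lintegral_map hf (by fun_prop)]

theorem gaussianTransition_zero (x : ℝ) : gaussianTransition 0 x = gaussianReal 0 1 := by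
  simp [gaussianTransition_apply]

/-- After the two steps the point is `r (R x + Z) + Z'` with independent centered noises, of
variance `r² (1 - R²) + (1 - r²) = 1 - (R r)²`. The bounds on `r` and `R` keep `toNNReal` from
truncating. -/
theorem gaussianTransition_comp {r R : ℝ} (hr : |r| ≤ 1) (hR : |R| ≤ 1) (x : ℝ) :
    (gaussianTransition r ∘ₖ gaussianTransition R) x = gaussianTransition (R * r) x := by
  have hr2 : r ^ 2 ≤ 1 := (sq_le_one_iff_abs_le_one r).2 hr
  have hR2 : R ^ 2 ≤ 1 := (sq_le_one_iff_abs_le_one R).2 hR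
  have hconv : (gaussianTransition r ∘ₖ gaussianTransition R) x
      = (gaussianTransition R x).map (r * ·) ∗ gaussianReal 0 (1 - r ^ 2).toNNReal := by
    refine Measure.ext_of_lintegral _ fun f hf => ?_
    rw [Kernel.lintegral_comp _ _ _ hf, Measure.lintegral_conv hf,
      lintegral_map (by fun_prop) (by fun_prop)]
    simp_rw [lintegral_gaussianTransition r _ hf]
  rw [hconv, gaussianTransition_apply, gaussianReal_map_const_mul, gaussianReal_conv_gaussianReal,
    gaussianTransition_apply]
  congr 1
  · ring
  · ext
    have h : 0 ≤ 1 - (R * r) ^ 2 := by nlinarith [sq_nonneg r, sq_nonneg R]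
    simp only [NNReal.coe_add, NNReal.coe_mul, NNReal.coe_mk,
      Real.coe_toNNReal _ (sub_nonneg.2 hr2), Real.coe_toNNReal _ (sub_nonneg.2 hR2),
      Real.coe_toNNReal _ h]
    ring

/-- If `Y - ρ X₀` is independent of `X` with law `N(0, 1 - ρ²)`, where `X₀ = c(X)`, then the joint
law of `X` and `Y` is given by the Gaussian transition kernel. -/
theorem map_prodMk_eq_compProd {Ω E : Type*} [MeasurableSpace Ω] [MeasurableSpace E]
    {Q : Measure Ω} [IsProbabilityMeasure Q] {X : Ω → E} {Y : Ω → ℝ} {c : E → ℝ} {ρ : ℝ}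
    (hX : Measurable X) (hY : Measurable Y) (hc : Measurable c)
    (hind : IndepFun X (fun ω => Y ω - ρ * c (X ω)) Q)
    (hlaw : Q.map (fun ω => Y ω - ρ * c (X ω)) = gaussianReal 0 (1 - ρ ^ 2).toNNReal) :
    Q.map (fun ω => (X ω, Y ω)) = Q.map X ⊗ₘ (gaussianTransition ρ).comap c hc := by
  have hZ : Measurable fun ω => Y ω - ρ * c (X ω) := by fun_prop
  have := Measure.isProbabilityMeasure_map hX.aemeasurable (μ := Q)
  rw [indepFun_iff_map_prod_eq_prod_map_map hX.aemeasurable hZ.aemeasurable, hlaw] at hind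
  have hΦ : Measurable fun p : E × ℝ => (p.1, ρ * c p.1 + p.2) := by fun_prop
  have h1 : (fun ω => (X ω, Y ω))
      = (fun p : E × ℝ => (p.1, ρ * c p.1 + p.2)) ∘ fun ω => (X ω, Y ω - ρ * c (X ω)) := by
    ext ω <;> simp
  rw [h1, ← Measure.map_map hΦ (hX.prodMk hZ), hind]
  refine Measure.ext_of_lintegral _ fun f hf => ?_
  rw [lintegral_map hf hΦ, lintegral_prod _ (by fun_prop), Measure.lintegral_compProd hf]
  refine lintegral_congr fun x => ?_
  rw [Kernel.comap_apply, lintegral_gaussianTransition ρ _ (by fun_prop)]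

/-! ### Two-dimensional Gaussian laws -/

/-- The centered Gaussian law on `ℝ × ℝ` with unit variances and correlation `ρ ∈ [-1, 1]`. -/
def gaussianPair (ρ : ℝ) : ProbabilityMeasure (ℝ × ℝ) :=
  ⟨gaussianReal 0 1 ⊗ₘ gaussianTransition ρ, inferInstance⟩

theorem coe_gaussianPair (ρ : ℝ) :
    (gaussianPair ρ : Measure (ℝ × ℝ)) = gaussianReal 0 1 ⊗ₘ gaussianTransition ρ := rfl

theorem fst_gaussianPair (ρ : ℝ) : (gaussianPair ρ : Measure (ℝ × ℝ)).fst = gaussianReal 0 1 := by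
  rw [coe_gaussianPair, Measure.fst_compProd]

theorem snd_gaussianPair {ρ : ℝ} (hρ : |ρ| ≤ 1) :
    (gaussianPair ρ : Measure (ℝ × ℝ)).snd = gaussianReal 0 1 := by
  -- For `R = 0` the first kernel is constantly `N(0, 1)`, so the composition rule expresses
  -- invariance of `N(0, 1)`.
  have h := gaussianTransition_comp hρ (R := 0) (by simp) 0
  rw [Kernel.comp_apply, zero_mul, gaussianTransition_zero] at h
  rw [coe_gaussianPair, Measure.snd_compProd, h]

/-- Disintegrations are unique only almost everywhere. This is why a standard normal marginal must
be at hand whenever `condKernel` is replaced by the explicit kernel. -/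
theorem condKernel_gaussianPair (ρ : ℝ) :
    ⇑(gaussianPair ρ : Measure (ℝ × ℝ)).condKernel =ᵐ[gaussianReal 0 1] gaussianTransition ρ := by
  have h := eq_condKernel_of_measure_eq_compProd (ρ := (gaussianPair ρ : Measure (ℝ × ℝ)))
    (gaussianTransition ρ) (by rw [fst_gaussianPair, coe_gaussianPair])
  rw [fst_gaussianPair] at h
  filter_upwards [h] with x hx using hx.symm

/-- Realizes all pairs on one probability space, continuously in `ρ`, so that weak convergence
reduces to dominated convergence. No bound on `ρ` is needed: for `|ρ| > 1` both `toNNReal` and `√`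
give `0`. -/
theorem gaussianPair_eq_map (ρ : ℝ) :
    (gaussianPair ρ : Measure (ℝ × ℝ)) = ((gaussianReal 0 1).prod (gaussianReal 0 1)).map
      fun p => (p.1, ρ * p.1 + √(1 - ρ ^ 2) * p.2) := by
  refine Measure.ext_of_lintegral _ fun f hf => ?_
  rw [coe_gaussianPair, Measure.lintegral_compProd hf, lintegral_map hf (by fun_prop),
    lintegral_prod _ (by fun_prop)]
  refine lintegral_congr fun x => ?_
  have h : gaussianReal 0 (1 - ρ ^ 2).toNNReal
      = (gaussianReal 0 1).map (√(1 - ρ ^ 2) * ·) := by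
    rw [gaussianReal_map_const_mul, mul_zero, mul_one]
    congr 1
    ext
    simp only [Real.coe_toNNReal', NNReal.coe_mk]
    rcases le_total 0 (1 - ρ ^ 2) with h | h
    · rw [max_eq_left h, Real.sq_sqrt h]
    · rw [max_eq_right h, Real.sqrt_eq_zero_of_nonpos h]; simp
  rw [lintegral_gaussianTransition ρ x (by fun_prop), h, lintegral_map (by fun_prop) (by fun_prop)]

theorem tendsto_gaussianPair {ι : Type*} {l : Filter ι} {r : ι → ℝ} {ρ : ℝ}
    [l.IsCountablyGenerated] (hr : Tendsto r l (𝓝 ρ)) :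
    Tendsto (fun i => gaussianPair (r i)) l (𝓝 (gaussianPair ρ)) := by
  rw [ProbabilityMeasure.tendsto_iff_forall_integral_tendsto]
  intro f
  have hmap (ρ : ℝ) : ∫ p, f p ∂(gaussianPair ρ : Measure (ℝ × ℝ))
      = ∫ p : ℝ × ℝ, f (p.1, ρ * p.1 + √(1 - ρ ^ 2) * p.2)
        ∂(gaussianReal 0 1).prod (gaussianReal 0 1) := by
    rw [gaussianPair_eq_map, integral_map (by fun_prop) f.continuous.aestronglyMeasurable]
  simp_rw [hmap]
  refine tendsto_integral_filter_of_dominated_convergence (fun _ => ‖f‖)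
    (Eventually.of_forall fun i => ?_)
    (Eventually.of_forall fun i => Eventually.of_forall fun p => f.norm_coe_le_norm _)
    (integrable_const _) (Eventually.of_forall fun p => ?_)
  · exact (f.continuous.comp (by fun_prop)).aestronglyMeasurable
  · have hc : Continuous fun ρ : ℝ => f (p.1, ρ * p.1 + √(1 - ρ ^ 2) * p.2) :=
      f.continuous.comp (by fun_prop)
    exact (hc.tendsto ρ).comp hr

/-! ### Concatenations of Gaussian plans -/

theorem concat_succ (μ : ProbabilityMeasure ℝ) (n : ℕ)
    (Q : Fin (n + 1) → ProbabilityMeasure (ℝ × ℝ)) :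
    (concat μ (n + 1) Q : Measure (Fin (n + 2) → ℝ)) =
      ((concat μ n fun i => Q i.castSucc : Measure (Fin (n + 1) → ℝ)) ⊗ₘ
          ((Q (Fin.last n) : Measure (ℝ × ℝ)).condKernel.comap
            (fun x : Fin (n + 1) → ℝ => x (Fin.last n)) (measurable_pi_apply _))).map
          (fun p => (Fin.snoc p.1 p.2 : Fin (n + 2) → ℝ)) := rfl

/-- In a concatenation the disintegration kernel of the last plan, when this plan is
`gaussianPair ρ`, may be replaced by the Gaussian transition kernel. -/
theorem compProd_condKernel_gaussianPair {n : ℕ} (μ : ProbabilityMeasure (Fin (n + 1) → ℝ)) (ρ : ℝ)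
    (hμ : (μ : Measure (Fin (n + 1) → ℝ)).map (fun x => x (Fin.last n)) = gaussianReal 0 1) :
    (μ : Measure (Fin (n + 1) → ℝ)) ⊗ₘ ((gaussianPair ρ : Measure (ℝ × ℝ)).condKernel.comap
        (fun x : Fin (n + 1) → ℝ => x (Fin.last n)) (measurable_pi_apply _))
      = (μ : Measure (Fin (n + 1) → ℝ)) ⊗ₘ ((gaussianTransition ρ).comap
        (fun x : Fin (n + 1) → ℝ => x (Fin.last n)) (measurable_pi_apply _)) := by
  refine Measure.compProd_congr ?_
  have h := condKernel_gaussianPair ρ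
  rw [← hμ] at h
  filter_upwards [ae_of_ae_map (measurable_pi_apply _).aemeasurable h] with x hx
  rw [Kernel.comap_apply, Kernel.comap_apply, hx]

/-- The standard Gaussian law as a `ProbabilityMeasure`. -/
def stdNormal : ProbabilityMeasure ℝ := ⟨gaussianReal 0 1, inferInstance⟩

theorem coe_stdNormal : (stdNormal : Measure ℝ) = gaussianReal 0 1 := rfl

/-- Correlation `1` is the empty product: this is the composition along no plan at all. -/
theorem gaussianPair_one_eq_map :
    (gaussianPair 1 : Measure (ℝ × ℝ)) = (gaussianReal 0 1).map fun x => (x, x) := by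
  refine Measure.ext_of_lintegral _ fun f hf => ?_
  rw [coe_gaussianPair, Measure.lintegral_compProd hf, lintegral_map hf (by fun_prop)]
  refine lintegral_congr fun x => ?_
  rw [gaussianTransition_apply]
  simp only [one_mul, one_pow, sub_self, Real.toNNReal_zero, gaussianReal_zero_var]
  rw [lintegral_dirac' _ (by fun_prop)]

theorem abs_prod_le_one {n : ℕ} {r : Fin n → ℝ} (hr : ∀ i, |r i| ≤ 1) : |∏ i, r i| ≤ 1 := by
  rw [Finset.abs_prod]
  exact Finset.prod_le_one (fun _ _ => abs_nonneg _) fun i _ => hr i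

/-- The first and last coordinates under the concatenation of the plans `gaussianPair (r i)` have
law `gaussianPair (∏ r i)`. -/
theorem map_concat_gaussianPair : ∀ (n : ℕ) (r : Fin n → ℝ), (∀ i, |r i| ≤ 1) →
    (concat stdNormal n fun i => gaussianPair (r i) : Measure (Fin (n + 1) → ℝ)).map
      (fun x => (x 0, x (Fin.last n))) = (gaussianPair (∏ i, r i) : Measure (ℝ × ℝ))
  | 0, r, _ => by
    rw [concat, ProbabilityMeasure.toMeasure_map,
      Measure.map_map (by fun_prop) (by fun_prop), Fin.prod_univ_zero, gaussianPair_one_eq_map,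
      coe_stdNormal]
    rfl
  | n + 1, r, hr => by
    set μ := concat stdNormal n fun i => gaussianPair (r i.castSucc) with hμ
    have hR : |∏ i : Fin n, r i.castSucc| ≤ 1 := abs_prod_le_one fun i => hr _
    have ih := map_concat_gaussianPair n (fun i => r i.castSucc) fun i => hr _
    rw [← hμ] at ih
    have hlast : (μ : Measure (Fin (n + 1) → ℝ)).map (fun x => x (Fin.last n))
        = gaussianReal 0 1 := by
      rw [← snd_gaussianPair hR, ← ih, Measure.snd, Measure.map_map (by fun_prop) (by fun_prop)]
      rfl
    rw [concat_succ, ← hμ, compProd_condKernel_gaussianPair μ _ hlast,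
      Measure.map_map (by fun_prop) (measurable_snoc n)]
    refine Measure.ext_of_lintegral _ fun f hf => ?_
    have hsnoc : (fun x : Fin (n + 2) → ℝ => (x 0, x (Fin.last (n + 1)))) ∘
        (fun p : (Fin (n + 1) → ℝ) × ℝ => (Fin.snoc p.1 p.2 : Fin (n + 2) → ℝ))
          = fun p => (p.1 0, p.2) := by
      funext p
      have h0 : (Fin.snoc p.1 p.2 : Fin (n + 2) → ℝ) 0 = p.1 0 :=
        Fin.snoc_castSucc (α := fun _ => ℝ) p.2 p.1 0
      simp [h0]
    have hF : Measurable fun q : ℝ × ℝ =>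
        ∫⁻ y, f (q.1, y) ∂gaussianTransition (r (Fin.last n)) q.2 := by
      have := Measurable.lintegral_kernel_prod_right'
        (κ := (gaussianTransition (r (Fin.last n))).comap (Prod.snd : ℝ × ℝ → ℝ) measurable_snd)
        (f := fun q : (ℝ × ℝ) × ℝ => f (q.1.1, q.2)) (by fun_prop)
      simpa only [Kernel.comap_apply] using this
    rw [hsnoc, lintegral_map hf (by fun_prop), Measure.lintegral_compProd (by fun_prop)]
    simp_rw [Kernel.comap_apply]
    -- The new plan sees only the last old coordinate, so the old path enters through its two end
    -- coordinates, whose joint law is the induction hypothesis.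
    calc ∫⁻ x, ∫⁻ y, f (x 0, y) ∂gaussianTransition (r (Fin.last n)) (x (Fin.last n))
          ∂(μ : Measure (Fin (n + 1) → ℝ))
        = ∫⁻ q, ∫⁻ y, f (q.1, y) ∂gaussianTransition (r (Fin.last n)) q.2
          ∂(μ : Measure (Fin (n + 1) → ℝ)).map (fun x => (x 0, x (Fin.last n))) := by
          rw [lintegral_map hF (by fun_prop)]
      _ = ∫⁻ a, ∫⁻ y, f (a, y) ∂(gaussianTransition (r (Fin.last n)) ∘ₖ
            gaussianTransition (∏ i : Fin n, r i.castSucc)) a ∂gaussianReal 0 1 := by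
          rw [ih, coe_gaussianPair, Measure.lintegral_compProd hF]
          refine lintegral_congr fun a => ?_
          rw [Kernel.lintegral_comp _ _ _ (by fun_prop)]
      _ = ∫⁻ p, f p ∂(gaussianPair (∏ i, r i) : Measure (ℝ × ℝ)) := by
          rw [coe_gaussianPair, Measure.lintegral_compProd hf]
          refine lintegral_congr fun a => ?_
          rw [gaussianTransition_comp (hr _) hR, Fin.prod_univ_castSucc]

/-! ### Finite-dimensional laws of centered Gaussian measures -/

section Laws

variable {T : Set ℝ} {K : T → T → ℝ} {Q : ProbabilityMeasure (T → ℝ)}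

theorem IsCenteredGaussian.memLp (hQ : IsCenteredGaussian K Q) (t : T) :
    MemLp (fun x : T → ℝ => x t) 2 (Q : Measure (T → ℝ)) :=
  (hQ.gaussian.hasGaussianLaw_eval t).memLp_two

/-- Joint law of finitely many coordinates and of the coordinate at a further time `t`, when the
covariances with `t` are proportional to those with one of these times. -/
theorem IsCenteredGaussian.map_prodMk_eq_compProd (hQ : IsCenteredGaussian K Q)
    (hone : ∀ t, K t t = 1) {ι : Type*} [Finite ι] (τ : ι → T) (i₀ : ι) (t : T) {ρ : ℝ}
    (hρ : ∀ i, K (τ i) t = ρ * K (τ i) (τ i₀)) :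
    (Q : Measure (T → ℝ)).map (fun x => (fun i => x (τ i), x t)) =
      (Q : Measure (T → ℝ)).map (fun x i => x (τ i)) ⊗ₘ
        (gaussianTransition ρ).comap (fun y : ι → ℝ => y i₀) (measurable_pi_apply i₀) := by
  classical
  -- The residual `x t - ρ x (τ i₀)` is adjoined to the coordinates at the times `τ i`. By `hρ` it
  -- is uncorrelated with each of them, hence independent of them by joint Gaussianity.
  have hgauss : IsGaussianProcess (Sum.elim (fun (i : ι) (x : T → ℝ) => x (τ i))
      (fun (_ : Unit) (x : T → ℝ) => x t - ρ * x (τ i₀))) (Q : Measure (T → ℝ)) := by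
    refine hQ.gaussian.of_isGaussianProcess ?_
    rintro (i | _)
    · exact ⟨{τ i}, .proj ⟨τ i, by simp⟩, fun x => rfl⟩
    · exact ⟨{t, τ i₀}, .proj ⟨t, by simp⟩ - ρ • .proj ⟨τ i₀, by simp⟩, fun x => rfl⟩
  have hZ : MemLp (fun x : T → ℝ => ρ * x (τ i₀)) 2 (Q : Measure (T → ℝ)) :=
    (hQ.memLp (τ i₀)).const_mul ρ
  have hcov (u : T) : cov[fun x : T → ℝ => x u, fun x => x t - ρ * x (τ i₀);
      (Q : Measure (T → ℝ))] = K u t - ρ * K u (τ i₀) := by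
    have h := covariance_sub_right (hQ.memLp u) (hQ.memLp t) hZ
    rw [covariance_const_mul_right, hQ.covariance, hQ.covariance] at h
    exact h
  have hind := hgauss.indepFun_of_covariance_eq_zero
    (fun i => (measurable_pi_apply _).aemeasurable)
    (fun _ => (by fun_prop : Measurable fun x : T → ℝ => x t - ρ * x (τ i₀)).aemeasurable)
    (fun i _ => by rw [hcov, hρ, sub_self])
  refine LocalMarkov.map_prodMk_eq_compProd (by fun_prop) (by fun_prop) _
    (hind.comp measurable_id (measurable_pi_apply ())) ?_
  have hlaw : HasGaussianLaw (fun x : T → ℝ => x t - ρ * x (τ i₀)) (Q : Measure (T → ℝ)) :=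
    hgauss.hasGaussianLaw_eval (Sum.inr ())
  rw [hlaw.map_eq_gaussianReal]
  congr 2
  · rw [integral_sub ((hQ.memLp t).integrable (by norm_num)) (hZ.integrable (by norm_num)),
      integral_const_mul, hQ.centered, hQ.centered]
    simp
  -- The residual is uncorrelated with `x (τ i₀)`, so its variance is its covariance with `x t`,
  -- namely `1 - ρ²`.
  · have hsymm : K t (τ i₀) = K (τ i₀) t := by
      rw [← hQ.covariance, ← hQ.covariance, covariance_comm]
    have h1 : K (τ i₀) t = ρ := by rw [hρ, hone, mul_one]
    rw [← covariance_self hlaw.aemeasurable]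
    have h := covariance_sub_left (hQ.memLp t) hZ ((hQ.memLp t).sub hZ)
    rw [covariance_const_mul_left] at h
    change cov[fun x : T → ℝ => x t - ρ * x (τ i₀), fun x => x t - ρ * x (τ i₀);
      (Q : Measure (T → ℝ))] = cov[fun x : T → ℝ => x t, fun x => x t - ρ * x (τ i₀);
      (Q : Measure (T → ℝ))] - ρ * cov[fun x : T → ℝ => x (τ i₀), fun x => x t - ρ * x (τ i₀);
      (Q : Measure (T → ℝ))] at h
    rw [h, hcov, hcov, hsymm, h1, hone, hone]
    ring

theorem IsCenteredGaussian.map_eval (hQ : IsCenteredGaussian K Q) (hone : ∀ t, K t t = 1) (t : T) :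
    (Q : Measure (T → ℝ)).map (fun x => x t) = gaussianReal 0 1 := by
  have h := hQ.gaussian.hasGaussianLaw_eval t
  rw [h.map_eq_gaussianReal, hQ.centered, ← covariance_self h.aemeasurable, hQ.covariance, hone]
  simp

theorem IsCenteredGaussian.law₁_eq (hQ : IsCenteredGaussian K Q) (hone : ∀ t, K t t = 1) (t : T) :
    law₁ Q t = stdNormal :=
  Subtype.ext (hQ.map_eval hone t)

theorem IsCenteredGaussian.law₂_eq (hQ : IsCenteredGaussian K Q) (hone : ∀ t, K t t = 1)
    (s t : T) : law₂ Q s t = gaussianPair (K s t) := by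
  refine ProbabilityMeasure.toMeasure_injective ?_
  have h := hQ.map_prodMk_eq_compProd hone (fun _ : Unit => s) () t (ρ := K s t)
    fun _ => by rw [hone, mul_one]
  have h2 := congrArg (Measure.map (fun p : (Unit → ℝ) × ℝ => (p.1 (), p.2))) h
  rw [Measure.map_map (by fun_prop) (by fun_prop)] at h2
  change (Q : Measure (T → ℝ)).map (fun x => (x s, x t)) = _
  refine Eq.trans h2 ?_
  refine Measure.ext_of_lintegral _ fun f hf => ?_
  change _ = ∫⁻ p, f p ∂(gaussianReal 0 1 ⊗ₘ gaussianTransition (K s t))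
  have hF : Measurable fun q : ℝ => ∫⁻ y, f (q, y) ∂gaussianTransition (K s t) q :=
    Measurable.lintegral_kernel_prod_right' hf
  have : IsProbabilityMeasure ((Q : Measure (T → ℝ)).map fun x (_ : Unit) => x s) :=
    Measure.isProbabilityMeasure_map
      (by fun_prop : Measurable fun (x : T → ℝ) (_ : Unit) => x s).aemeasurable
  rw [lintegral_map hf (by fun_prop), Measure.lintegral_compProd (by fun_prop),
    Measure.lintegral_compProd hf, ← hQ.map_eval hone s, lintegral_map hF (by fun_prop)]
  exact lintegral_map (hF.comp (measurable_pi_apply ()))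
    (by fun_prop : Measurable fun (x : T → ℝ) (_ : Unit) => x s)

/-- The variances of `x s ± x t` are `2 ± 2 K s t` and nonnegative. -/
theorem IsCenteredGaussian.abs_kernel_le_one (hQ : IsCenteredGaussian K Q)
    (hone : ∀ t, K t t = 1) (s t : T) : |K s t| ≤ 1 := by
  have hself (u : T) : Var[fun x : T → ℝ => x u; (Q : Measure (T → ℝ))] = 1 := by
    rw [← covariance_self (measurable_pi_apply u).aemeasurable, hQ.covariance, hone]
  have hadd := variance_nonneg (fun x : T → ℝ => x s + x t) (Q : Measure (T → ℝ))
  have hsub := variance_nonneg (fun x : T → ℝ => x s - x t) (Q : Measure (T → ℝ))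
  rw [variance_fun_add (hQ.memLp s) (hQ.memLp t), hself, hself, hQ.covariance] at hadd
  rw [variance_fun_sub (hQ.memLp s) (hQ.memLp t), hself, hself, hQ.covariance] at hsub
  rw [abs_le]
  constructor <;> linarith

/-- Composition along a partition multiplies the correlations. -/
theorem IsCenteredGaussian.compose_eq (hQ : IsCenteredGaussian K Q) (hone : ∀ t, K t t = 1)
    {s t : T} (R : Partition s t) :
    compose Q R = gaussianPair (∏ i : Fin R.size, K (R.pts i.castSucc) (R.pts i.succ)) := by
  refine ProbabilityMeasure.toMeasure_injective ?_
  rw [← map_concat_gaussianPair _ _ fun i => hQ.abs_kernel_le_one hone _ _]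
  simp only [compose, hQ.law₁_eq hone, hQ.law₂_eq hone]
  rfl

/-- A centered Gaussian measure with unit variances and multiplicative covariance function is a
Markov measure. -/
theorem IsCenteredGaussian.isMarkovMeasure (hQ : IsCenteredGaussian K Q) (hone : ∀ t, K t t = 1)
    (hmul : ∀ r s t : T, r ≤ s → s ≤ t → K r t = K s t * K r s) : IsMarkovMeasure Q := by
  intro n
  induction n with
  | zero =>
    intro t _
    refine ProbabilityMeasure.toMeasure_injective ?_
    rw [concat, ProbabilityMeasure.toMeasure_map, law₁, ProbabilityMeasure.toMeasure_map,
      Measure.map_map (by fun_prop) (by fun_prop)]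
    change (Q : Measure (T → ℝ)).map _ = _
    congr 1
    funext x i
    obtain rfl : i = 0 := Fin.fin_one_eq_zero i
    rfl
  | succ n ih =>
    intro t ht
    have ih' := ih (fun i => t i.castSucc) (ht.comp Fin.strictMono_castSucc)
    refine ProbabilityMeasure.toMeasure_injective ?_
    change _ = (concat (law₁ Q (t 0)) (n + 1) _ : Measure (Fin (n + 2) → ℝ))
    rw [concat_succ]
    have hc : (concat (law₁ Q (t 0)) n fun i : Fin n =>
        law₂ Q (t i.castSucc.castSucc) (t i.castSucc.succ)) = lawFin Q fun i => t i.castSucc :=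
      ih'.symm
    have hlast : (lawFin Q fun i => t i.castSucc : Measure (Fin (n + 1) → ℝ)).map
        (fun x => x (Fin.last n)) = gaussianReal 0 1 := by
      rw [← hQ.map_eval hone (t (Fin.last n).castSucc), lawFin, ProbabilityMeasure.toMeasure_map,
        Measure.map_map (by fun_prop) (by fun_prop)]
      rfl
    rw [hc, hQ.law₂_eq hone, compProd_condKernel_gaussianPair _ _ hlast]
    -- Multiplicativity of `K` is exactly the required proportionality: covariances with the new
    -- time are `ρ` times those with the last old time.
    have h := hQ.map_prodMk_eq_compProd hone (fun i : Fin (n + 1) => t i.castSucc) (Fin.last n)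
      (t (Fin.last (n + 1))) (ρ := K (t (Fin.last n).castSucc) (t (Fin.last n).succ)) fun i => by
        rw [Fin.succ_last]
        exact hmul _ _ _ (ht.monotone (Fin.castSucc_le_castSucc_iff.2 (Fin.le_last i)))
          (ht.monotone (Fin.le_last _))
    have h2 := congrArg (Measure.map
      (fun p : (Fin (n + 1) → ℝ) × ℝ => (Fin.snoc p.1 p.2 : Fin (n + 2) → ℝ))) h
    rw [Measure.map_map (measurable_snoc n) (by fun_prop)] at h2
    refine Eq.trans ?_ h2
    change (Q : Measure (T → ℝ)).map _ = _
    congr 1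
    funext x i
    refine Fin.lastCases ?_ (fun j => ?_) i <;> simp

end Laws

/-! ### Isonormal Gaussian processes -/

/-- The product of standard Gaussian laws. -/
def gaussianProduct (ι : Type) : Measure (ι → ℝ) := Measure.infinitePi fun _ => gaussianReal 0 1

instance instIsProbabilityMeasureGaussianProduct (ι : Type) :
    IsProbabilityMeasure (gaussianProduct ι) := by
  unfold gaussianProduct; infer_instance

section Isonormal

variable {ι : Type}

theorem map_eval_gaussianProduct (i : ι) :
    (gaussianProduct ι).map (fun ω => ω i) = gaussianReal 0 1 :=
  (measurePreserving_eval_infinitePi (fun _ : ι => gaussianReal 0 1) i).map_eq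

theorem hasGaussianLaw_eval_gaussianProduct (i : ι) :
    HasGaussianLaw (fun ω : ι → ℝ => ω i) (gaussianProduct ι) :=
  ⟨by rw [map_eval_gaussianProduct]; infer_instance⟩

theorem integral_eval_gaussianProduct (i : ι) : ∫ ω, ω i ∂gaussianProduct ι = 0 := by
  have h := integral_map (μ := gaussianProduct ι) (φ := fun ω => ω i) (f := fun x : ℝ => x)
    (measurable_pi_apply i).aemeasurable (by fun_prop)
  rw [← h, map_eval_gaussianProduct, integral_id_gaussianReal]

theorem integral_mul_eval_gaussianProduct [DecidableEq ι] (i j : ι) :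
    ∫ ω, ω i * ω j ∂gaussianProduct ι = if i = j then 1 else 0 := by
  split_ifs with h
  · subst h
    have h2 := variance_of_integral_eq_zero (measurable_pi_apply i).aemeasurable
      (integral_eval_gaussianProduct i)
    have h3 := variance_map (μ := gaussianProduct ι) (X := id) (Y := fun ω => ω i)
      (by fun_prop) (measurable_pi_apply i).aemeasurable
    rw [map_eval_gaussianProduct, variance_id_gaussianReal] at h3
    change _ = Var[fun ω : ι → ℝ => ω i; gaussianProduct ι] at h3
    rw [← h3] at h2
    simpa [sq] using h2.symm
  · have hind := (iIndepFun_infinitePi (P := fun _ : ι => gaussianReal 0 1)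
      (X := fun _ x => x) fun _ => measurable_id).indepFun h
    have h2 := hind.integral_fun_mul_eq_mul_integral
      (measurable_pi_apply i).aestronglyMeasurable (measurable_pi_apply j).aestronglyMeasurable
    refine h2.trans ?_
    change (∫ ω, ω i ∂gaussianProduct ι) * _ = 0
    rw [integral_eval_gaussianProduct, zero_mul]

/-- The coordinates of the product space as elements of `L²`. -/
def coordLp (i : ι) : Lp ℝ 2 (gaussianProduct ι) :=
  (hasGaussianLaw_eval_gaussianProduct i).memLp_two.toLp _

theorem coeFn_coordLp (i : ι) : coordLp i =ᵐ[gaussianProduct ι] fun ω => ω i :=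
  MemLp.coeFn_toLp _

theorem orthonormal_coordLp : Orthonormal ℝ (coordLp : ι → Lp ℝ 2 (gaussianProduct ι)) := by
  classical
  rw [orthonormal_iff_ite]
  intro i j
  rw [L2.inner_def, ← integral_mul_eval_gaussianProduct i j]
  refine integral_congr_ae ?_
  filter_upwards [coeFn_coordLp i, coeFn_coordLp j] with ω hi hj
  rw [hi, hj]
  simp [mul_comm]

theorem hasGaussianLaw_linearCombination (c : ι →₀ ℝ) :
    HasGaussianLaw (fun ω : ι → ℝ => Finsupp.linearCombination ℝ ω c) (gaussianProduct ι) := by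
  have hind := (iIndepFun_infinitePi (P := fun _ : ι => gaussianReal 0 1)
    (X := fun _ x => x) fun _ => measurable_id).precomp
    (Subtype.val_injective (p := fun i => i ∈ c.support))
  have h := iIndepFun.hasGaussianLaw (P := gaussianProduct ι)
    (X := fun (i : c.support) ω => ω (i : ι)) (fun i => hasGaussianLaw_eval_gaussianProduct (i : ι))
    hind
  have h2 := h.map (∑ i : c.support, c i • ContinuousLinearMap.proj (R := ℝ) (φ := fun _ => ℝ) i)
  refine h2.congr (Eventually.of_forall fun ω => ?_)
  simp [Finsupp.linearCombination_apply, Finsupp.sum, Finset.sum_attach c.support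
    (fun i => c i * ω i)]

theorem integral_linearCombination (c : ι →₀ ℝ) :
    ∫ ω : ι → ℝ, Finsupp.linearCombination ℝ ω c ∂gaussianProduct ι = 0 := by
  simp_rw [Finsupp.linearCombination_apply, Finsupp.sum]
  rw [integral_finsetSum]
  · simp_rw [smul_eq_mul, integral_const_mul, integral_eval_gaussianProduct]
    simp
  · exact fun i _ => (hasGaussianLaw_eval_gaussianProduct i).integrable.const_mul _

end Isonormal

theorem map_eq_gaussianReal_norm {Ω : Type*} [MeasurableSpace Ω] {P : Measure Ω}
    [IsProbabilityMeasure P] {g : Lp ℝ 2 P} (hg : HasGaussianLaw g P) (h0 : ∫ ω, g ω ∂P = 0) :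
    P.map g = gaussianReal 0 (‖g‖ ^ 2).toNNReal := by
  rw [hg.map_eq_gaussianReal, h0, variance_of_integral_eq_zero hg.aemeasurable h0,
    ← real_inner_self_eq_norm_sq, L2.inner_def]
  simp

/-- An isonormal Gaussian process over a Hilbert space. -/
theorem exists_isonormal (H : Type) [NormedAddCommGroup H] [InnerProductSpace ℝ H]
    [CompleteSpace H] :
    ∃ (ι : Type) (W : H →ₗᵢ[ℝ] Lp ℝ 2 (gaussianProduct ι)), ∀ h,
      (gaussianProduct ι).map (W h) = gaussianReal 0 (‖h‖ ^ 2).toNNReal := by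
  classical
  obtain ⟨w, b, -⟩ := exists_hilbertBasis ℝ H
  have hO := (orthonormal_coordLp (ι := w)).orthogonalFamily
  -- `W` sends a Hilbert basis to independent standard normal coordinates.
  let W : H →ₗᵢ[ℝ] Lp ℝ 2 (gaussianProduct w) :=
    hO.linearIsometry.comp b.repr.toLinearIsometry
  have hWb (i : w) : W (b i) = coordLp i := by
    change hO.linearIsometry (b.repr (b i)) = _
    rw [b.repr_self, hO.linearIsometry_apply_single]
    simp
  refine ⟨w, W, ?_⟩
  have hspan : ∀ h ∈ Submodule.span ℝ (Set.range b), ∃ c : w →₀ ℝ,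
      W h =ᵐ[gaussianProduct w] fun ω => Finsupp.linearCombination ℝ ω c := by
    intro h hh
    induction hh using Submodule.span_induction with
    | mem x hx =>
      obtain ⟨i, rfl⟩ := hx
      refine ⟨Finsupp.single i 1, ?_⟩
      rw [hWb]
      filter_upwards [coeFn_coordLp i] with ω hω
      simp [hω]
    | zero =>
      refine ⟨0, ?_⟩
      rw [map_zero]
      filter_upwards with ω
      simp
    | add x y _ _ hx hy =>
      obtain ⟨c, hc⟩ := hx
      obtain ⟨d, hd⟩ := hy
      refine ⟨c + d, ?_⟩
      rw [map_add]
      filter_upwards [Lp.coeFn_add (W x) (W y), hc, hd] with ω hω h1 h2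
      rw [hω, Pi.add_apply, h1, h2, map_add]
    | smul a x _ hx =>
      obtain ⟨c, hc⟩ := hx
      refine ⟨a • c, ?_⟩
      rw [map_smul]
      filter_upwards [Lp.coeFn_smul a (W x), hc] with ω hω h1
      rw [hω, Pi.smul_apply, h1, map_smul]
  have hspan_law : ∀ h ∈ Submodule.span ℝ (Set.range b),
      (gaussianProduct w).map (W h) = gaussianReal 0 (‖h‖ ^ 2).toNNReal := by
    intro h hh
    obtain ⟨c, hc⟩ := hspan h hh
    rw [map_eq_gaussianReal_norm ((hasGaussianLaw_linearCombination c).congr hc.symm)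
      ((integral_congr_ae hc).trans (integral_linearCombination c)), W.norm_map]
  intro h
  have hh : h ∈ closure (Submodule.span ℝ (Set.range b) : Set H) := by
    rw [← Submodule.topologicalClosure_coe, b.dense_span]
    trivial
  obtain ⟨x, hx, hlim⟩ := mem_closure_iff_seq_limit.1 hh
  -- The law is known on the dense span of the basis. `L²` convergence implies convergence in law,
  -- and the characteristic function of `N(0, ‖y‖²)` is continuous in `y`, so the formula passes to
  -- the limit.
  have hmeas := tendstoInMeasure_of_tendsto_Lp ((W.continuous.tendsto h).comp hlim)
  have hdist := (hmeas.tendstoInDistribution fun n => (Lp.aestronglyMeasurable _).aemeasurable).tendsto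
  replace hdist := (ProbabilityMeasure.tendsto_iff_tendsto_charFun (E := ℝ)).1 hdist
  have : IsProbabilityMeasure ((gaussianProduct w).map (W h)) :=
    Measure.isProbabilityMeasure_map (Lp.aestronglyMeasurable _).aemeasurable
  refine Measure.ext_of_charFun ?_
  funext u
  refine tendsto_nhds_unique (hdist u) ?_
  have hcont : Continuous fun y : H => charFun (gaussianReal 0 (‖y‖ ^ 2).toNNReal) u := by
    simp_rw [charFun_gaussianReal]
    fun_prop
  refine ((hcont.tendsto h).comp hlim).congr fun n => ?_
  simp only [Function.comp_apply, ProbabilityMeasure.coe_mk]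
  rw [hspan_law _ (hx n)]

/-! ### Existence and uniqueness of centered Gaussian measures -/

/-- A kernel with a feature map into a Hilbert space is the covariance function of a centered
Gaussian measure. -/
theorem exists_isCenteredGaussian {T : Set ℝ} {K : T → T → ℝ} {H : Type} [NormedAddCommGroup H]
    [InnerProductSpace ℝ H] [CompleteSpace H] (f : T → H) (hf : ∀ s t, inner ℝ (f s) (f t) = K s t) :
    ∃ Q : ProbabilityMeasure (T → ℝ), IsCenteredGaussian K Q := by
  obtain ⟨ι, W, hW⟩ := exists_isonormal H
  have hae (h : H) : AEMeasurable (W h) (gaussianProduct ι) :=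
    (Lp.aestronglyMeasurable _).aemeasurable
  have hgauss (h : H) : HasGaussianLaw (W h) (gaussianProduct ι) :=
    ⟨by rw [hW]; infer_instance⟩
  have hmean (h : H) : ∫ ω, W h ω ∂gaussianProduct ι = 0 := by
    have := integral_map (f := fun x : ℝ => x) (hae h) (by fun_prop)
    rw [← this, hW, integral_id_gaussianReal]
  have hcov (g h : H) : cov[W g, W h; gaussianProduct ι] = inner ℝ g h := by
    rw [covariance_eq_sub (hgauss g).memLp_two (hgauss h).memLp_two, hmean, zero_mul, sub_zero,
      ← W.inner_map_map, L2.inner_def]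
    refine integral_congr_ae (Eventually.of_forall fun ω => ?_)
    simp [mul_comm]
  -- Elements of `L²` are only classes; a measurable representative at each time gives a measurable
  -- map into `ℝ^T`. Each later check involves finitely many times, so the exceptional null sets do
  -- no harm.
  let X : T → (ι → ℝ) → ℝ := fun t => (hae (f t)).mk
  have hX (t : T) : Measurable (X t) := (hae (f t)).measurable_mk
  have hXW (t : T) : X t =ᵐ[gaussianProduct ι] W (f t) := (hae (f t)).ae_eq_mk.symm
  have hXm : Measurable fun ω t => X t ω := measurable_pi_lambda _ hX
  let Q : ProbabilityMeasure (T → ℝ) :=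
    ⟨(gaussianProduct ι).map fun ω t => X t ω, Measure.isProbabilityMeasure_map hXm.aemeasurable⟩
  have hQ : (Q : Measure (T → ℝ)) = (gaussianProduct ι).map fun ω t => X t ω := rfl
  refine ⟨Q, ⟨⟨fun I => ⟨?_⟩⟩, fun t => ?_, fun s t => ?_⟩⟩
  · rw [hQ, Measure.map_map (by fun_prop) hXm]
    refine isGaussian_of_map_eq_gaussianReal fun L => ?_
    rw [Measure.map_map (by fun_prop) (by fun_prop)]
    -- By linearity of `W`, a linear form of the finite-dimensional vector is again some `W h`,
    -- hence Gaussian.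
    have hL : (L ∘ (fun x : T → ℝ => I.restrict x) ∘ fun ω t => X t ω)
        =ᵐ[gaussianProduct ι] W (∑ i : I, L (Pi.single i 1) • f i) := by
      have h1 : ∀ᵐ ω ∂gaussianProduct ι, ∀ i : I, X i ω = W (f i) ω :=
        ae_all_iff.2 fun i => hXW i
      have h2 : (W (∑ i : I, L (Pi.single i 1) • f i) : (ι → ℝ) → ℝ) =ᵐ[gaussianProduct ι]
          fun ω => ∑ i : I, L (Pi.single i 1) * W (f i) ω := by
        rw [map_sum]
        refine (Lp.coeFn_fun_finsetSum _ _).trans ?_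
        have h3 : ∀ᵐ ω ∂gaussianProduct ι, ∀ i : I,
            W (L (Pi.single i 1) • f i) ω = L (Pi.single i 1) * W (f i) ω := by
          refine ae_all_iff.2 fun i => ?_
          rw [map_smul]
          exact Lp.coeFn_smul _ _
        filter_upwards [h3] with ω hω
        exact Finset.sum_congr rfl fun i _ => hω i
      filter_upwards [h1, h2] with ω hω1 hω2
      rw [hω2, Function.comp_apply, Function.comp_apply]
      conv_lhs => rw [← Finset.univ_sum_single (I.restrict fun t => X t ω)]
      rw [map_sum]
      refine Finset.sum_congr rfl fun i _ => ?_
      rw [← hω1 i, mul_comm, ← smul_eq_mul, ← map_smul, ← Pi.single_smul]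
      simp
    rw [Measure.map_congr hL, hW]
    exact ⟨_, _, rfl⟩
  · rw [hQ, integral_map hXm.aemeasurable (measurable_pi_apply t).aestronglyMeasurable,
      ← hmean (f t)]
    exact integral_congr_ae (hXW t)
  · rw [hQ, covariance_map_fun (measurable_pi_apply s).aestronglyMeasurable
      (measurable_pi_apply t).aestronglyMeasurable hXm.aemeasurable, ← hf, ← hcov]
    simp only [covariance]
    rw [integral_congr_ae (hXW s), integral_congr_ae (hXW t)]
    refine integral_congr_ae ?_
    filter_upwards [hXW s, hXW t] with ω hs ht
    rw [hs, ht]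

/-- A centered Gaussian measure is determined by its covariance function. -/
theorem IsCenteredGaussian.unique {T : Set ℝ} {K : T → T → ℝ} {P Q : ProbabilityMeasure (T → ℝ)}
    (hP : IsCenteredGaussian K P) (hQ : IsCenteredGaussian K Q) : P = Q := by
  -- The characteristic functions of the finite-dimensional laws involve `K` alone.
  have hchar (R : ProbabilityMeasure (T → ℝ)) (hR : IsCenteredGaussian K R) (I : Finset T)
      (L : StrongDual ℝ (I → ℝ)) : charFunDual ((R : Measure (T → ℝ)).map I.restrict) L
        = Complex.exp (- ((∑ i : I, ∑ j : I, L (Pi.single i 1) * (L (Pi.single j 1)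
          * K i j) : ℝ) : ℂ) / 2) := by
    have hL : (fun x : T → ℝ => L (I.restrict x))
        = fun x => ∑ i : I, L (Pi.single i 1) * x i := by
      funext x
      conv_lhs => rw [← Finset.univ_sum_single (I.restrict x)]
      rw [map_sum]
      refine Finset.sum_congr rfl fun i _ => ?_
      rw [mul_comm, ← smul_eq_mul, ← map_smul, ← Pi.single_smul]
      simp
    have hmem (i : I) : MemLp (fun x : T → ℝ => L (Pi.single i 1) * x i) 2
        (R : Measure (T → ℝ)) := (hR.memLp i).const_mul _
    have hg := (hR.gaussian.hasGaussianLaw I).charFunDual_map_eq_fun L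
    change charFunDual ((R : Measure (T → ℝ)).map I.restrict) L = _ at hg
    have hmean : ∫ x : T → ℝ, L (I.restrict x) ∂(R : Measure (T → ℝ)) = 0 := by
      rw [hL, integral_finsetSum _ fun i _ => (hmem i).integrable (by norm_num)]
      simp_rw [integral_const_mul, hR.centered]
      simp
    have hvar : Var[fun x : T → ℝ => L (I.restrict x); (R : Measure (T → ℝ))]
        = ∑ i : I, ∑ j : I, L (Pi.single i 1) * (L (Pi.single j 1) * K i j) := by
      rw [← covariance_self (by fun_prop), hL, covariance_fun_sum_fun_sum hmem hmem]
      simp_rw [covariance_const_mul_left, covariance_const_mul_right, hR.covariance]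
    rw [hg]
    change Complex.exp (((∫ x : T → ℝ, L (I.restrict x) ∂(R : Measure (T → ℝ)) : ℝ) : ℂ) *
      Complex.I - (Var[fun x : T → ℝ => L (I.restrict x); (R : Measure (T → ℝ))] : ℂ) / 2) = _
    rw [hmean, hvar]
    simp [neg_div]
  refine ProbabilityMeasure.toMeasure_injective ?_
  have hfin (I : Finset T) : IsProbabilityMeasure ((P : Measure (T → ℝ)).map I.restrict) :=
    Measure.isProbabilityMeasure_map (by fun_prop)
  have hfin' (I : Finset T) : IsProbabilityMeasure ((Q : Measure (T → ℝ)).map I.restrict) :=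
    Measure.isProbabilityMeasure_map (by fun_prop)
  refine IsProjectiveLimit.unique (P := fun I => (P : Measure (T → ℝ)).map I.restrict)
    (fun I => rfl) fun I => ?_
  refine Measure.ext_of_charFunDual ?_
  funext L
  rw [hchar P hP, hchar Q hQ]

/-! ### The exponential kernels -/

theorem expKernel_top (T : Set ℝ) (s t : T) : expKernel T ∞ s t = if s = t then 1 else 0 := by
  split_ifs with h
  · simp [expKernel, h]
  · have h2 : ENNReal.ofReal |(t : ℝ) - s| ≠ 0 := by
      rw [ENNReal.ofReal_ne_zero_iff, abs_pos, sub_ne_zero]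
      exact fun h' => h (Subtype.ext h'.symm)
    simp [expKernel, ENNReal.top_mul h2]

theorem expKernel_of_ne_top (T : Set ℝ) {α : ℝ≥0∞} (hα : α ≠ ∞) (s t : T) :
    expKernel T α s t = Real.exp (-(α.toReal * |(t : ℝ) - s|)) := by
  lift α to NNReal using hα
  have h : ((α * ENNReal.ofReal |(t : ℝ) - s| : ℝ≥0∞) : EReal)
      = ((α * |(t : ℝ) - s| : ℝ) : EReal) := by
    rw [← ENNReal.ofReal_coe_nnreal, ← ENNReal.ofReal_mul α.coe_nonneg,
      EReal.coe_ennreal_ofReal, max_eq_left (by positivity)]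
  rw [expKernel, h, ← EReal.coe_neg, EReal.exp_coe, ENNReal.toReal_ofReal (Real.exp_nonneg _),
    ENNReal.coe_toReal]

theorem expKernel_self (T : Set ℝ) (α : ℝ≥0∞) (t : T) : expKernel T α t t = 1 := by
  simp [expKernel]

theorem expKernel_mul (T : Set ℝ) (α : ℝ≥0∞) {r s t : T} (hrs : r ≤ s) (hst : s ≤ t) :
    expKernel T α r t = expKernel T α s t * expKernel T α r s := by
  rcases eq_or_ne α ∞ with rfl | hα
  · simp only [expKernel_top]
    by_cases h1 : r = s
    · subst h1; simp
    · have h2 : r ≠ t := fun h => h1 (le_antisymm hrs (h ▸ hst))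
      simp [h1, h2]
  · have h1 : (r : ℝ) ≤ s := hrs
    have h2 : (s : ℝ) ≤ t := hst
    simp only [expKernel_of_ne_top T hα]
    rw [← Real.exp_add, abs_of_nonneg (by linarith), abs_of_nonneg (by linarith),
      abs_of_nonneg (by linarith)]
    congr 1
    ring

/-- For `α = ∞` an orthonormal family indexed by `T` is a feature map. For finite `α = a` the
vectors `e^{-at} 1_{(0, e^{2at}]}` of `L²(ℝ)` work, with inner products `e^{-a(s+t)} e^{2a min(s,t)}
= e^{-a|t-s|}`; this is the Ornstein–Uhlenbeck process as a time-changed Brownian motion. -/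
theorem exists_isCenteredGaussian_expKernel (T : Set ℝ) (α : ℝ≥0∞) :
    ∃ Q : ProbabilityMeasure (T → ℝ), IsCenteredGaussian (expKernel T α) Q := by
  classical
  rcases eq_or_ne α ∞ with rfl | hα
  · refine exists_isCenteredGaussian (H := lp (fun _ : T => ℝ) 2)
      (fun t => lp.single 2 t (1 : ℝ)) fun s t => ?_
    rw [lp.inner_single_left, expKernel_top]
    by_cases h : s = t
    · subst h; simp
    · simp [h]
  · set a := α.toReal
    refine exists_isCenteredGaussian (H := Lp ℝ 2 (volume : Measure ℝ))
      (fun t => Real.exp (-(a * t)) • indicatorConstLp 2 (measurableSet_Ioc (a := 0)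
        (b := Real.exp (2 * a * t))) measure_Ioc_lt_top.ne (1 : ℝ)) fun s t => ?_
    rw [inner_smul_left, inner_smul_right, L2.inner_indicatorConstLp_indicatorConstLp
      (hμs := measure_Ioc_lt_top.ne) (hμt := measure_Ioc_lt_top.ne),
      Set.Ioc_inter_Ioc, Measure.real, Real.volume_Ioc, expKernel_of_ne_top T hα]
    have ha : 0 ≤ a := ENNReal.toReal_nonneg
    wlog hst : (s : ℝ) ≤ t generalizing s t
    · have := this t s (le_of_not_ge hst)
      rw [abs_sub_comm, ← this]
      simp only [conj_trivial, min_comm]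
      ring
    have h1 : 2 * a * (s : ℝ) ≤ 2 * a * t := by gcongr
    rw [min_eq_left (Real.exp_le_exp.2 h1), abs_of_nonneg (by linarith)]
    simp only [conj_trivial, max_self, sub_zero]
    rw [ENNReal.toReal_ofReal (Real.exp_nonneg _)]
    simp only [smul_eq_mul, real_inner_self_eq_norm_sq, norm_one, one_pow, mul_one]
    rw [← Real.exp_add, ← Real.exp_add]
    congr 1
    ring

/-! ### Products of numbers close to one -/

theorem prod_le_exp_neg_sum {ι : Type*} (s : Finset ι) {r : ι → ℝ} (hr : ∀ i ∈ s, 0 ≤ r i) :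
    ∏ i ∈ s, r i ≤ Real.exp (-∑ i ∈ s, (1 - r i)) := by
  rw [← Finset.sum_neg_distrib, Real.exp_sum]
  refine Finset.prod_le_prod hr fun i _ => ?_
  have := Real.add_one_le_exp (-(1 - r i))
  linarith

/-- Termwise, `log r ≥ 1 - 1/r = -(1 - r)/r ≥ -(1 - r)/(1 - ε)`. -/
theorem exp_neg_sum_div_le_prod {ι : Type*} (s : Finset ι) {r : ι → ℝ} {ε : ℝ} (hε : ε < 1)
    (hr : ∀ i ∈ s, 1 - ε ≤ r i) (hr1 : ∀ i ∈ s, r i ≤ 1) :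
    Real.exp (-((∑ i ∈ s, (1 - r i)) / (1 - ε))) ≤ ∏ i ∈ s, r i := by
  rw [Finset.sum_div, ← Finset.sum_neg_distrib, Real.exp_sum]
  refine Finset.prod_le_prod (fun _ _ => Real.exp_nonneg _) fun i hi => ?_
  have hε' : 0 < 1 - ε := sub_pos.2 hε
  have hpos : 0 < r i := hε'.trans_le (hr i hi)
  rw [← Real.le_log_iff_exp_le hpos]
  have h1 := Real.one_sub_inv_le_log_of_pos hpos
  have h2 : (1 - r i) / r i ≤ (1 - r i) / (1 - ε) :=
    div_le_div_of_nonneg_left (sub_nonneg.2 (hr1 i hi)) hε' (hr i hi)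
  have h3 : (1 - r i) / r i = (r i)⁻¹ - 1 := by field_simp
  linarith

theorem tendsto_prod_exp_neg {N : ℕ → ℕ} {r : ∀ n, Fin (N n) → ℝ} {c : ℝ}
    (hr : ∀ ε > 0, ∀ᶠ n in atTop, ∀ i, 1 - ε ≤ r n i) (hr1 : ∀ n i, r n i ≤ 1)
    (hsum : Tendsto (fun n => ∑ i, (1 - r n i)) atTop (𝓝 c)) :
    Tendsto (fun n => ∏ i, r n i) atTop (𝓝 (Real.exp (-c))) := by
  rw [tendsto_order]
  constructor
  · intro a ha
    -- As `c / (1 - ε) → c` when `ε → 0`, some fixed `ε > 0` keeps the limit of the lower bounds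
    -- above `a`.
    have hcont : ContinuousAt (fun ε : ℝ => Real.exp (-(c / (1 - ε)))) 0 := by
      refine (ContinuousAt.neg ?_).rexp
      exact continuousAt_const.div (by fun_prop) (by norm_num)
    have hε : ∀ᶠ ε in 𝓝[>] (0 : ℝ), a < Real.exp (-(c / (1 - ε))) ∧ ε < 1 := by
      have h0 : a < Real.exp (-(c / (1 - 0))) := by simpa using ha
      exact nhdsWithin_le_nhds ((hcont.eventually_const_lt h0).and (gt_mem_nhds one_pos))
    obtain ⟨ε, ⟨haε, hε1⟩, hε0⟩ := (hε.and self_mem_nhdsWithin).exists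
    have hlim : Tendsto (fun n => Real.exp (-((∑ i, (1 - r n i)) / (1 - ε)))) atTop
        (𝓝 (Real.exp (-(c / (1 - ε))))) :=
      (Real.continuous_exp.tendsto _).comp (hsum.div_const _).neg
    filter_upwards [hlim.eventually_const_lt haε, hr ε hε0] with n h1 h2
    exact h1.trans_le (exp_neg_sum_div_le_prod _ hε1 (fun i _ => h2 i) fun i _ => hr1 n i)
  · intro a ha
    have hlim := (Real.continuous_exp.tendsto _).comp hsum.neg
    -- The choice `ε = 1` just says that the factors are nonnegative.
    filter_upwards [hlim.eventually_lt_const ha, hr 1 one_pos] with n h1 h2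
    exact (prod_le_exp_neg_sum _ fun i _ => by simpa using h2 i).trans_lt h1

theorem tendsto_prod_zero {N : ℕ → ℕ} {r : ∀ n, Fin (N n) → ℝ}
    (hr : ∀ᶠ n in atTop, ∀ i, 0 ≤ r n i)
    (hsum : Tendsto (fun n => ∑ i, (1 - r n i)) atTop atTop) :
    Tendsto (fun n => ∏ i, r n i) atTop (𝓝 0) := by
  refine squeeze_zero' ?_ ?_ (Real.tendsto_exp_atBot.comp (tendsto_neg_atTop_atBot.comp hsum))
  · filter_upwards [hr] with n hn using Finset.prod_nonneg fun i _ => hn i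
  · filter_upwards [hr] with n hn using prod_le_exp_neg_sum _ fun i _ => hn i

/-! ### Increments of partitions -/

section Partitions

variable {T : Set ℝ} {s t : T}

/-- The `i`-th increment of a partition. -/
def Partition.incr (R : Partition s t) (i : Fin R.size) : ℝ :=
  (R.pts i.succ : ℝ) - (R.pts i.castSucc : ℝ)

theorem Partition.incr_pos (R : Partition s t) (i : Fin R.size) : 0 < R.incr i :=
  sub_pos.2 (R.strictMono Fin.castSucc_lt_succ)

theorem Partition.incr_le_mesh (R : Partition s t) (i : Fin R.size) : R.incr i ≤ R.mesh :=
  (le_abs_self _).trans (le_ciSup (f := fun i : Fin R.size =>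
    |(R.pts i.succ : ℝ) - (R.pts i.castSucc : ℝ)|) (Set.finite_range _).bddAbove i)

theorem Partition.sum_incr (R : Partition s t) : ∑ i, R.incr i = (t : ℝ) - s := by
  have h : ∀ (n : ℕ) (f : Fin (n + 1) → ℝ),
      ∑ i : Fin n, (f i.succ - f i.castSucc) = f (Fin.last n) - f 0 := by
    intro n f
    have h1 := Fin.sum_univ_succ f
    have h2 := Fin.sum_univ_castSucc f
    rw [Finset.sum_sub_distrib]
    linarith
  have := h R.size fun i => (R.pts i : ℝ)
  rw [R.pts_zero, R.pts_last] at this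
  exact this

theorem Partition.mesh_nonneg (R : Partition s t) : 0 ≤ R.mesh :=
  Real.iSup_nonneg fun _ => abs_nonneg _

theorem Partition.pts_succ_le (R : Partition s t) (i : Fin R.size) {u : T}
    (hu : u ∈ Set.range R.pts) (h : R.pts i.castSucc < u) : R.pts i.succ ≤ u := by
  obtain ⟨j, rfl⟩ := hu
  refine R.strictMono.monotone ?_
  have := R.strictMono.lt_iff_lt.1 h
  exact Fin.castSucc_lt_iff_succ_le.1 this

theorem range_gridPartition {δ : ℝ} (hδ : 0 < δ) (hst : s < t) :
    Set.range (gridPartition hδ hst).pts = gridSet δ s t := by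
  change Set.range (Finset.orderEmbOfFin (gridSet_finite hδ s t).toFinset _) = _
  rw [Finset.range_orderEmbOfFin, Set.Finite.coe_toFinset]

/-- As `T` is an interval, a multiple of `δ` between two consecutive points would be a time in `T`,
hence itself a grid point. -/
theorem Partition.not_lt_mul_lt (hT : T.OrdConnected) {δ : ℝ} {R : Partition s t}
    (hR : Set.range R.pts = gridSet δ s t) (i : Fin R.size) (k : ℤ)
    (h1 : (R.pts i.castSucc : ℝ) < δ * k)
    (h2 : δ * k < (R.pts i.succ : ℝ)) : False := by
  have hs : s ≤ R.pts i.castSucc :=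
    R.pts_zero.symm.le.trans (R.strictMono.monotone (Fin.zero_le _))
  have ht : R.pts i.succ ≤ t := (R.strictMono.monotone (Fin.le_last _)).trans R.pts_last.le
  let u : T := ⟨δ * k, hT.out (R.pts i.castSucc).2 (R.pts i.succ).2 ⟨h1.le, h2.le⟩⟩
  have hu1 : R.pts i.castSucc < u := h1
  have hu2 : u < R.pts i.succ := h2
  have hu : u ∈ Set.range R.pts := by
    rw [hR]
    exact Or.inl ⟨⟨hs.trans_lt hu1, hu2.trans_le ht⟩, k, rfl⟩
  exact (R.pts_succ_le i hu hu1).not_gt hu2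

theorem Partition.incr_le_of_range_eq (hT : T.OrdConnected) {δ : ℝ} (hδ : 0 < δ) {R : Partition s t}
    (hR : Set.range R.pts = gridSet δ s t) (i : Fin R.size) : R.incr i ≤ δ := by
  by_contra! h
  rw [Partition.incr] at h
  set a : ℝ := (R.pts i.castSucc : ℝ) with ha
  have h1 := Int.floor_le (a / δ)
  have h2 := Int.lt_floor_add_one (a / δ)
  rw [le_div_iff₀ hδ] at h1
  rw [div_lt_iff₀ hδ] at h2
  -- The first multiple of `δ` beyond the left end would lie strictly inside an increment longer
  -- than `δ`.
  refine Partition.not_lt_mul_lt hT hR i (⌊a / δ⌋ + 1) ?_ ?_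
  · push_cast; linarith
  · push_cast; linarith

theorem mesh_gridPartition_le (hT : T.OrdConnected) {δ : ℝ} (hδ : 0 < δ) (hst : s < t) :
    (gridPartition hδ hst).mesh ≤ δ := by
  refine Real.iSup_le (fun i => ?_) hδ.le
  have h := Partition.incr_le_of_range_eq hT hδ (range_gridPartition hδ hst) i
  have h' := (gridPartition hδ hst).incr_pos i
  rw [Partition.incr] at h h'
  rwa [abs_of_pos h']

/-- Both ends of such an increment are multiples of `δ`, so its length is a positive multiple of `δ`
that is at most `δ`. -/
theorem Partition.incr_eq_of_range_eq (hT : T.OrdConnected) {δ : ℝ} (hδ : 0 < δ) {R : Partition s t}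
    (hR : Set.range R.pts = gridSet δ s t) (i : Fin R.size) (h0 : 0 < (i : ℕ))
    (h1 : (i : ℕ) + 1 < R.size) : R.incr i = δ := by
  have hmul (j : Fin (R.size + 1)) (hj0 : 0 < (j : ℕ))
      (hj1 : (j : ℕ) < R.size) :
      ∃ k : ℤ, (R.pts j : ℝ) = δ * k := by
    have hj : R.pts j ∈ gridSet δ s t := by
      rw [← hR]; exact ⟨j, rfl⟩
    rcases hj with ⟨-, hk⟩ | hj | hj
    · exact hk
    · have := R.strictMono.injective (hj.trans R.pts_zero.symm)
      simp [this] at hj0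
    · have := R.strictMono.injective (Eq.trans hj R.pts_last.symm)
      simp [this] at hj1
  obtain ⟨k, hk⟩ := hmul i.castSucc h0 i.2
  obtain ⟨l, hl⟩ := hmul i.succ (by simp) (by simpa using h1)
  have hpos := R.incr_pos i
  have hle := Partition.incr_le_of_range_eq hT hδ hR i
  rw [Partition.incr, hk, hl, ← mul_sub] at hpos hle ⊢
  have h3 : (0 : ℝ) < l - k := pos_of_mul_pos_right hpos hδ.le
  have h4 : (l : ℝ) - k ≤ 1 := by
    by_contra! h
    nlinarith
  have h5 : l - k = 1 := by
    have h3' : 0 < l - k := by exact_mod_cast h3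
    have h4' : l - k ≤ 1 := by exact_mod_cast h4
    omega
  have h6 : (l : ℝ) - k = 1 := by exact_mod_cast h5
  rw [h6, mul_one]

end Partitions

/-- Sums over increments all equal to `δ`, but possibly for the first and the last one. -/
theorem exists_sum_incr_eq {N : ℕ} {h : Fin N → ℝ} {δ : ℝ} (hpos : ∀ i, 0 < h i)
    (hle : ∀ i, h i ≤ δ) (heq : ∀ i : Fin N, 0 < (i : ℕ) → (i : ℕ) + 1 < N → h i = δ)
    (hδ : 0 < δ) (hsum : δ < ∑ i, h i) :
    ∃ (m : ℕ) (a b : ℝ), (0 < a ∧ a ≤ δ) ∧ (0 < b ∧ b ≤ δ) ∧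
      ∀ g : ℝ → ℝ, ∑ i, g (h i) = g a + m * g δ + g b := by
  -- A total above `δ` excludes fewer than two increments, so the first and the last are distinct.
  match N, h, hpos, hle, heq, hsum with
  | 0, h, _, _, _, hsum => simp at hsum; linarith
  | 1, h, _, hle, _, hsum =>
    have := hle 0
    simp at hsum
    linarith
  | m + 2, h, hpos, hle, heq, _ =>
    refine ⟨m, h 0, h (Fin.last (m + 1)), ⟨hpos _, hle _⟩, ⟨hpos _, hle _⟩, fun g => ?_⟩
    rw [Fin.sum_univ_succ, Fin.sum_univ_castSucc]
    have hmid (j : Fin m) : h j.castSucc.succ = δ := heq _ (by simp) (by simp)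
    simp [hmid, add_assoc]

/-! ### Convergence of the compositions -/

/-- If the `r_i` tend to `1` uniformly and `∑ (1 - r_i) → α (t - s)` in `[0, ∞]`, then `∏ r_i` tends
to `exp (-α (t - s))`. -/
theorem tendsto_prod_expKernel {T : Set ℝ} {α : ℝ≥0∞} {s t : T} (hst : s < t) {N : ℕ → ℕ}
    {r : ∀ n, Fin (N n) → ℝ} (hr : ∀ ε > 0, ∀ᶠ n in atTop, ∀ i, 1 - ε ≤ r n i)
    (hr1 : ∀ n i, r n i ≤ 1)
    (hfin : α ≠ ∞ → Tendsto (fun n => ∑ i, (1 - r n i)) atTop (𝓝 (α.toReal * ((t : ℝ) - s))))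
    (htop : α = ∞ → Tendsto (fun n => ∑ i, (1 - r n i)) atTop atTop) :
    Tendsto (fun n => ∏ i, r n i) atTop (𝓝 (expKernel T α s t)) := by
  by_cases hα : α = ∞
  · have h := tendsto_prod_zero (by simpa using hr 1 one_pos) (htop hα)
    rwa [hα, expKernel_top, if_neg hst.ne]
  · have h := tendsto_prod_exp_neg hr hr1 (hfin hα)
    have hst' : (s : ℝ) < t := hst
    rwa [expKernel_of_ne_top T hα, abs_of_pos (sub_pos.2 hst')]

theorem tendsto_decayRate_of_ne_top {ι : Type*} {l : Filter ι} {Kt : ℝ → ℝ} {h : ι → ℝ}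
    {α : ℝ≥0∞} (hα : α ≠ ∞) (hlim : Tendsto (fun i => decayRate Kt (h i)) l (𝓝 (α : EReal))) :
    Tendsto (fun i => (h i)⁻¹ * (1 - Kt (h i))) l (𝓝 α.toReal) := by
  rw [← EReal.coe_toReal (x := (α : EReal)) (by simpa using hα) (EReal.coe_ennreal_ne_bot _),
    EReal.toReal_coe_ennreal] at hlim
  exact EReal.tendsto_coe.1 hlim

theorem tendsto_decayRate_top {ι : Type*} {l : Filter ι} {Kt : ℝ → ℝ} {h : ι → ℝ}
    (hlim : Tendsto (fun i => decayRate Kt (h i)) l (𝓝 ((∞ : ℝ≥0∞) : EReal))) :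
    Tendsto (fun i => (h i)⁻¹ * (1 - Kt (h i))) l atTop := by
  rw [EReal.coe_ennreal_top] at hlim
  exact EReal.tendsto_coe_nhds_top_iff.1 hlim

/-- `K̃` is constrained only on differences of points of `T`. Two distinct times make all small
positive `x` such differences, and continuity of `K` at `(s, s)` applies. -/
theorem tendsto_one_of_continuous {T : Set ℝ} (hT : T.OrdConnected) {K : T → T → ℝ} {Kt : ℝ → ℝ}
    (hstat : ∀ s t : T, K s t = Kt ((t : ℝ) - (s : ℝ)))
    (hcont : Continuous fun p : T × T => K p.1 p.2) (hone : Kt 0 = 1) {s t : T} (hst : s < t) :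
    Tendsto Kt (𝓝[>] 0) (𝓝 1) := by
  have hst' : (s : ℝ) < t := hst
  rw [Metric.tendsto_nhds]
  intro ε hε
  obtain ⟨η, hη, h⟩ := Metric.continuous_iff.1 hcont (s, s) ε hε
  have hmem : Set.Ioo 0 (min η ((t : ℝ) - s)) ∈ 𝓝[>] (0 : ℝ) :=
    Ioo_mem_nhdsGT (lt_min hη (sub_pos.2 hst'))
  filter_upwards [hmem] with x ⟨hx0, hx⟩
  rw [lt_min_iff] at hx
  have hxT : (s : ℝ) + x ∈ T := hT.out s.2 t.2 ⟨by linarith, by linarith⟩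
  have h1 := h (s, ⟨s + x, hxT⟩) (by
    rw [Prod.dist_eq, max_lt_iff]
    refine ⟨by simpa using hη, ?_⟩
    change dist ((s : ℝ) + x) s < η
    rw [Real.dist_eq, add_sub_cancel_left, abs_of_pos hx0]
    exact hx.1)
  simp only [hstat] at h1
  rwa [add_sub_cancel_left, sub_self, hone] at h1

section Convergence

variable {T : Set ℝ} {K : T → T → ℝ} {Kt : ℝ → ℝ} {P : ProbabilityMeasure (T → ℝ)} {s t : T}

theorem IsCenteredGaussian.compose_eq_of_stationary
    (hP : IsCenteredGaussian K P) (hstat : ∀ s t : T, K s t = Kt ((t : ℝ) - (s : ℝ)))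
    (hone : Kt 0 = 1) (R : Partition s t) :
    compose P R = gaussianPair (∏ i, Kt (R.incr i)) := by
  rw [hP.compose_eq fun t => by rw [hstat, sub_self, hone]]
  simp_rw [hstat]
  rfl

theorem IsCenteredGaussian.stationary_le_one
    (hP : IsCenteredGaussian K P) (hstat : ∀ s t : T, K s t = Kt ((t : ℝ) - (s : ℝ)))
    (hone : Kt 0 = 1) (R : Partition s t) (i : Fin R.size) : Kt (R.incr i) ≤ 1 := by
  have h := hP.abs_kernel_le_one (fun t => by rw [hstat, sub_self, hone]) (R.pts i.castSucc)
    (R.pts i.succ)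
  rw [hstat] at h
  exact (abs_le.1 h).2

theorem eventually_one_sub_le (hKt : Tendsto Kt (𝓝[>] 0) (𝓝 1)) {R : ℕ → Partition s t}
    (hR : Tendsto (fun n => (R n).mesh) atTop (𝓝 0)) :
    ∀ ε > 0, ∀ᶠ n in atTop, ∀ i, 1 - ε ≤ Kt ((R n).incr i) := by
  intro ε hε
  have h := hKt.eventually_const_le (show 1 - ε < 1 by linarith)
  rw [eventually_iff, mem_nhdsGT_iff_exists_Ioo_subset] at h
  obtain ⟨η, hη, h⟩ := h
  filter_upwards [hR.eventually_lt_const hη] with n hn i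
  exact h ⟨(R n).incr_pos i, ((R n).incr_le_mesh i).trans_lt hn⟩

theorem tendsto_compose_of_tendsto_decayRate (hP : IsCenteredGaussian K P)
    (hstat : ∀ s t : T, K s t = Kt ((t : ℝ) - (s : ℝ))) (hone : Kt 0 = 1)
    (hKt : Tendsto Kt (𝓝[>] 0) (𝓝 1)) (hst : s < t) {α : ℝ≥0∞}
    (hα : Tendsto (decayRate Kt) (𝓝[>] 0) (𝓝 (α : EReal))) {R : ℕ → Partition s t}
    (hR : Tendsto (fun n => (R n).mesh) atTop (𝓝 0)) :
    Tendsto (fun n => compose P (R n)) atTop (𝓝 (gaussianPair (expKernel T α s t))) := by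
  have hst' : 0 < (t : ℝ) - s := sub_pos.2 hst
  simp_rw [hP.compose_eq_of_stationary hstat hone]
  refine tendsto_gaussianPair (tendsto_prod_expKernel hst (eventually_one_sub_le hKt hR)
    (fun n i => hP.stationary_le_one hstat hone _ _) ?_ ?_)
  · intro hα'
    have hL := tendsto_decayRate_of_ne_top (h := fun x => x) hα' hα
    rw [Metric.tendsto_nhds] at hL ⊢
    intro ε hε
    -- Errors proportional to the increments add up to this tolerance times `t - s`, that is `ε /
    -- 2`.
    have h := hL (ε / (2 * ((t : ℝ) - s))) (by positivity)
    rw [eventually_iff, mem_nhdsGT_iff_exists_Ioo_subset] at h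
    obtain ⟨η, hη, h⟩ := h
    filter_upwards [hR.eventually_lt_const hη] with n hn
    have hterm (i : Fin (R n).size) : |1 - Kt ((R n).incr i) - α.toReal * (R n).incr i|
        ≤ ε / (2 * ((t : ℝ) - s)) * (R n).incr i := by
      have hpos := (R n).incr_pos i
      have hi := h ⟨hpos, ((R n).incr_le_mesh i).trans_lt hn⟩
      rw [Set.mem_ofPred_eq, Real.dist_eq] at hi
      have heq : 1 - Kt ((R n).incr i) - α.toReal * (R n).incr i
          = (((R n).incr i)⁻¹ * (1 - Kt ((R n).incr i)) - α.toReal) * (R n).incr i := by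
        field_simp
      rw [heq, abs_mul, abs_of_pos hpos]
      gcongr
    rw [Real.dist_eq, ← (R n).sum_incr, Finset.mul_sum, ← Finset.sum_sub_distrib]
    refine (Finset.abs_sum_le_sum_abs _ _).trans_lt
      ((Finset.sum_le_sum fun i _ => hterm i).trans_lt ?_)
    rw [← Finset.mul_sum, (R n).sum_incr]
    have : ε / (2 * ((t : ℝ) - s)) * ((t : ℝ) - s) = ε / 2 := by field_simp
    linarith
  · rintro rfl
    have hL := tendsto_decayRate_top (h := fun x => x) hα
    rw [tendsto_atTop]
    intro M
    -- If `L ≥ M / (t - s)` at all increments, the sum of the `h_i L(h_i)` is at least `M`.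
    have h := (tendsto_atTop.1 hL) (M / ((t : ℝ) - s))
    rw [eventually_iff, mem_nhdsGT_iff_exists_Ioo_subset] at h
    obtain ⟨η, hη, h⟩ := h
    filter_upwards [hR.eventually_lt_const hη] with n hn
    have hterm (i : Fin (R n).size) :
        M / ((t : ℝ) - s) * (R n).incr i ≤ 1 - Kt ((R n).incr i) := by
      have hpos := (R n).incr_pos i
      have hi := h ⟨hpos, ((R n).incr_le_mesh i).trans_lt hn⟩
      rw [Set.mem_ofPred_eq, inv_mul_eq_div, le_div_iff₀ hpos] at hi
      exact hi
    refine le_trans ?_ (Finset.sum_le_sum fun i _ => hterm i)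
    rw [← Finset.mul_sum, (R n).sum_incr, div_mul_cancel₀ _ hst'.ne']

theorem tendsto_mesh_gridPartition (hT : T.OrdConnected) (hst : s < t) {δ : ℕ → ℝ}
    (hδ : ∀ n, 0 < δ n) (hδ0 : Tendsto δ atTop (𝓝 0)) :
    Tendsto (fun n => (gridPartition (hδ n) hst).mesh) atTop (𝓝 0) :=
  squeeze_zero (fun _ => Partition.mesh_nonneg _) (fun n => mesh_gridPartition_le hT (hδ n) hst) hδ0

theorem tendsto_compose_gridPartition (hT : T.OrdConnected) (hP : IsCenteredGaussian K P)
    (hstat : ∀ s t : T, K s t = Kt ((t : ℝ) - (s : ℝ))) (hone : Kt 0 = 1)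
    (hKt : Tendsto Kt (𝓝[>] 0) (𝓝 1)) (hst : s < t) {α : ℝ≥0∞} {δ : ℕ → ℝ}
    (hδ : ∀ n, 0 < δ n) (hδ0 : Tendsto δ atTop (𝓝 0))
    (hα : Tendsto (fun n => decayRate Kt (δ n)) atTop (𝓝 (α : EReal))) :
    Tendsto (fun n => compose P (gridPartition (hδ n) hst)) atTop
      (𝓝 (gaussianPair (expKernel T α s t))) := by
  have hst' : 0 < (t : ℝ) - s := sub_pos.2 hst
  -- Once `δ n < t - s`, the triple `q` records the number of full steps and the two end increments;
  -- one triple serves all `g`, here the identity and `1 - K̃`.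
  have hsum : ∀ᶠ n in atTop, ∃ q : ℕ × ℝ × ℝ, (0 < q.2.1 ∧ q.2.1 ≤ δ n) ∧
      (0 < q.2.2 ∧ q.2.2 ≤ δ n) ∧ ∀ g : ℝ → ℝ,
        ∑ i, g ((gridPartition (hδ n) hst).incr i) = g q.2.1 + q.1 * g (δ n) + g q.2.2 := by
    filter_upwards [hδ0.eventually_lt_const hst'] with n hn
    obtain ⟨m, a, b, h⟩ := exists_sum_incr_eq (gridPartition (hδ n) hst).incr_pos
      (Partition.incr_le_of_range_eq hT (hδ n) (range_gridPartition (hδ n) hst))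
      (Partition.incr_eq_of_range_eq hT (hδ n) (range_gridPartition (hδ n) hst)) (hδ n)
      (by rwa [Partition.sum_incr])
    exact ⟨(m, a, b), h⟩
  obtain ⟨q, hq⟩ := skolem.1 hsum
  have hends {a : ℕ → ℝ} (ha : ∀ᶠ n in atTop, 0 < a n ∧ a n ≤ δ n) :
      Tendsto a atTop (𝓝[>] 0) := by
    refine tendsto_nhdsWithin_iff.2 ⟨?_, ha.mono fun n hn => hn.1⟩
    exact squeeze_zero' (ha.mono fun n hn => hn.1.le) (ha.mono fun n hn => hn.2) hδ0
  have ha := hends (hq.mono fun n hn => hn.1)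
  have hb := hends (hq.mono fun n hn => hn.2.1)
  -- Nothing is known about `L` at the end increments, but `K̃ → 1` makes their contribution vanish.
  have hend : Tendsto (fun n => (1 - Kt (q n).2.1) + (1 - Kt (q n).2.2)) atTop (𝓝 0) := by
    have := ((hKt.comp ha).const_sub 1).add ((hKt.comp hb).const_sub 1)
    simpa using this
  have hmid : Tendsto (fun n => (q n).1 * δ n) atTop (𝓝 ((t : ℝ) - s)) := by
    have h1 := (tendsto_nhdsWithin_iff.1 ha).1
    have h2 := (tendsto_nhdsWithin_iff.1 hb).1
    have h3 := ((h1.const_sub ((t : ℝ) - s)).sub h2)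
    rw [sub_zero, sub_zero] at h3
    refine h3.congr' ?_
    filter_upwards [hq] with n hn
    have := hn.2.2 fun x => x
    rw [Partition.sum_incr] at this
    linarith
  have hS : (fun n => ((q n).1 * δ n) * ((δ n)⁻¹ * (1 - Kt (δ n))) +
      ((1 - Kt (q n).2.1) + (1 - Kt (q n).2.2)))
      =ᶠ[atTop] fun n => ∑ i, (1 - Kt ((gridPartition (hδ n) hst).incr i)) := by
    filter_upwards [hq] with n hn
    rw [hn.2.2 fun x => 1 - Kt x]
    have := (hδ n).ne'
    field_simp
    ring
  simp_rw [hP.compose_eq_of_stationary hstat hone]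
  refine tendsto_gaussianPair (tendsto_prod_expKernel hst
    (eventually_one_sub_le hKt (tendsto_mesh_gridPartition hT hst hδ hδ0))
    (fun n i => hP.stationary_le_one hstat hone _ _) ?_ ?_)
  · intro hα'
    have h := (hmid.mul (tendsto_decayRate_of_ne_top hα' hα)).add hend
    rw [add_zero, mul_comm] at h
    exact h.congr' hS
  · rintro rfl
    exact ((hmid.pos_mul_atTop hst' (tendsto_decayRate_top hα)).atTop_add hend).congr' hS

end Convergence

/-! ### Local Markov transforms -/

/-- Partitions of arbitrarily small mesh exist. -/
theorem exists_partition_tendsto_mesh {T : Set ℝ} (hT : T.OrdConnected) {s t : T} (hst : s < t) :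
    ∃ R : ℕ → Partition s t, Tendsto (fun n => (R n).mesh) atTop (𝓝 0) :=
  ⟨_, tendsto_mesh_gridPartition hT hst (δ := fun n : ℕ => 1 / ((n : ℝ) + 1))
    (fun n => by positivity) tendsto_one_div_add_atTop_nhds_zero_nat⟩

/-- A Markov measure is determined by its two-dimensional laws. -/
theorem IsMarkovMeasure.unique {T : Set ℝ} {P Q : ProbabilityMeasure (T → ℝ)}
    (hT : T.Nontrivial) (hP : IsMarkovMeasure P) (hQ : IsMarkovMeasure Q)
    (h : ∀ s t : T, s < t → law₂ P s t = law₂ Q s t) : P = Q := by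
  have hfst (R : ProbabilityMeasure (T → ℝ)) (s t : T) :
      law₁ R s = (law₂ R s t).map (f := Prod.fst) (by fun_prop) := by
    refine ProbabilityMeasure.toMeasure_injective ?_
    simp only [law₁, law₂, ProbabilityMeasure.toMeasure_map]
    rw [Measure.map_map (by fun_prop) (by fun_prop)]
    rfl
  have hsnd (R : ProbabilityMeasure (T → ℝ)) (s t : T) :
      law₁ R t = (law₂ R s t).map (f := Prod.snd) (by fun_prop) := by
    refine ProbabilityMeasure.toMeasure_injective ?_
    simp only [law₁, law₂, ProbabilityMeasure.toMeasure_map]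
    rw [Measure.map_map (by fun_prop) (by fun_prop)]
    rfl
  have hone (t : T) : law₁ P t = law₁ Q t := by
    -- A second time is needed to read the law at `t` off a two-dimensional law.
    obtain ⟨u, hu, hne⟩ := hT.exists_ne (t : ℝ)
    rcases lt_or_gt_of_ne hne with hlt | hlt
    · rw [hsnd P ⟨u, hu⟩ t, hsnd Q ⟨u, hu⟩ t, h _ _ hlt]
    · rw [hfst P t ⟨u, hu⟩, hfst Q t ⟨u, hu⟩, h _ _ hlt]
  have hfin (n : ℕ) (t : Fin (n + 1) → T) (ht : StrictMono t) : lawFin P t = lawFin Q t := by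
    rw [hP n t ht, hQ n t ht, hone]
    congr 1
    funext i
    exact h _ _ (ht Fin.castSucc_lt_succ)
  refine ProbabilityMeasure.toMeasure_injective ?_
  have hprob (I : Finset T) : IsProbabilityMeasure ((P : Measure (T → ℝ)).map I.restrict) :=
    Measure.isProbabilityMeasure_map (by fun_prop)
  refine IsProjectiveLimit.unique (P := fun I => (P : Measure (T → ℝ)).map I.restrict)
    (fun I => rfl) fun I => ?_
  -- The Markov property concerns at least one time, so the empty index set is treated apart; there
  -- the space is a single point.
  rcases I.eq_empty_or_nonempty with rfl | hI
  · have hprob' : IsProbabilityMeasure ((Q : Measure (T → ℝ)).map (∅ : Finset T).restrict) :=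
      Measure.isProbabilityMeasure_map (by fun_prop)
    have hprob'' := hprob ∅
    ext A hA
    rcases A.eq_empty_or_nonempty with rfl | hA'
    · simp
    · rw [Subsingleton.eq_univ_of_nonempty hA', measure_univ, measure_univ]
  · have hc : I.card = (I.card - 1) + 1 := (Nat.succ_pred_eq_of_pos hI.card_pos).symm
    let e := I.orderIsoOfFin hc
    have hlaw := congrArg (fun μ : ProbabilityMeasure (Fin (I.card - 1 + 1) → ℝ) =>
        (μ : Measure (Fin (I.card - 1 + 1) → ℝ)).map fun x (i : I) => x (e.symm i))
      (hfin (I.card - 1) (fun i => e i) fun i j hij => e.strictMono hij)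
    simp only [lawFin, ProbabilityMeasure.toMeasure_map] at hlaw
    rw [Measure.map_map (by fun_prop) (by fun_prop),
      Measure.map_map (by fun_prop) (by fun_prop)] at hlaw
    have hcomp : ((fun (x : Fin (I.card - 1 + 1) → ℝ) (i : I) => x (e.symm i)) ∘
        fun (x : T → ℝ) i => x (e i)) = I.restrict := by
      funext x i
      simp
    rw [hcomp] at hlaw
    exact hlaw.symm

/-- Cluster points of the decay rate at `0⁺` are limits along sequences. -/
theorem exists_seq_tendsto_decayRate {Kt : ℝ → ℝ} {a : EReal}
    (h : MapClusterPt a (𝓝[>] 0) (decayRate Kt)) :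
    ∃ δ : ℕ → ℝ, (∀ n, 0 < δ n) ∧ Tendsto δ atTop (𝓝 0) ∧
      Tendsto (fun n => decayRate Kt (δ n)) atTop (𝓝 a) := by
  obtain ⟨δ, hδa, hδ⟩ := h.exists_seq_tendsto
  rw [tendsto_nhdsWithin_iff] at hδ
  obtain ⟨n, hn⟩ := eventually_atTop.1 hδ.2
  -- The extracted sequence is only eventually positive; its first terms are dropped.
  exact ⟨fun k => δ (k + n), fun k => hn _ (Nat.le_add_left _ _),
    (tendsto_add_atTop_iff_nat n).2 hδ.1, (tendsto_add_atTop_iff_nat n).2 hδa⟩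

end LocalMarkov

end

/-- For every `α ∈ [0, ∞]` there is exactly one centered Gaussian measure `Pα` with covariance
function `K_α`, and it has the stated properties. -/
theorem theorem4 (T : Set ℝ) (hT : T.OrdConnected)
    (K : T → T → ℝ) (Kt : ℝ → ℝ)
    (hpsd : LocalMarkov.IsPosSemidefKernel K)
    (hstat : ∀ s t : T, K s t = Kt ((t : ℝ) - (s : ℝ)))
    (hcont : Continuous fun p : T × T => K p.1 p.2)
    (hone : Kt 0 = 1)
    (P : ProbabilityMeasure (T → ℝ)) (hP : LocalMarkov.IsCenteredGaussian K P)
    (α : ℝ≥0∞) :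
    ∃ Pα : ProbabilityMeasure (T → ℝ),
      -- `Pα` is the centered Gaussian measure with covariance function `K_α`
      (LocalMarkov.IsCenteredGaussian (LocalMarkov.expKernel T α) Pα ∧
        ∀ Q : ProbabilityMeasure (T → ℝ),
          LocalMarkov.IsCenteredGaussian (LocalMarkov.expKernel T α) Q → Q = Pα) ∧
      -- first point: a limit of the decay rate gives the strong local Markov transform
      (Tendsto (LocalMarkov.decayRate Kt) (𝓝[>] 0) (𝓝 (α : EReal)) →
        LocalMarkov.IsStrongLocalMarkovTransform P Pα ∧
          (T.Nontrivial → ∀ Q : ProbabilityMeasure (T → ℝ),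
            LocalMarkov.IsStrongLocalMarkovTransform P Q → Q = Pα)) ∧
      -- second point: convergence along the grids
      (∀ (δ : ℕ → ℝ) (hδ : ∀ n, 0 < δ n), Tendsto δ atTop (𝓝 0) →
        Tendsto (fun n => LocalMarkov.decayRate Kt (δ n)) atTop (𝓝 (α : EReal)) →
        ∀ (s t : T) (hst : s < t),
          Tendsto (fun n => LocalMarkov.compose P (LocalMarkov.gridPartition (hδ n) hst)) atTop
            (𝓝 (LocalMarkov.law₂ Pα s t))) ∧
      -- in particular, a cluster point of the decay rate gives a weak local Markov transform
      (MapClusterPt (α : EReal) (𝓝[>] 0) (LocalMarkov.decayRate Kt) →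
        LocalMarkov.IsWeakLocalMarkovTransform P Pα) := by
  open LocalMarkov in
  obtain ⟨Pα, hPα⟩ := exists_isCenteredGaussian_expKernel T α
  have hlaw (s t : T) : law₂ Pα s t = gaussianPair (expKernel T α s t) :=
    hPα.law₂_eq (expKernel_self T α) s t
  have hmarkov : IsMarkovMeasure Pα :=
    hPα.isMarkovMeasure (expKernel_self T α) fun r s t => expKernel_mul T α
  have hKt {s t : T} (hst : s < t) : Tendsto Kt (𝓝[>] 0) (𝓝 1) :=
    tendsto_one_of_continuous hT hstat hcont hone hst
  have hgrid : ∀ (δ : ℕ → ℝ) (hδ : ∀ n, 0 < δ n), Tendsto δ atTop (𝓝 0) →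
      Tendsto (fun n => decayRate Kt (δ n)) atTop (𝓝 (α : EReal)) → ∀ (s t : T) (hst : s < t),
        Tendsto (fun n => compose P (gridPartition (hδ n) hst)) atTop (𝓝 (law₂ Pα s t)) := by
    intro δ hδ hδ0 hα s t hst
    rw [hlaw]
    exact tendsto_compose_gridPartition hT hP hstat hone (hKt hst) hst hδ hδ0 hα
  refine ⟨Pα, ⟨hPα, fun Q hQ => hQ.unique hPα⟩, fun hα => ?_, hgrid, fun hα => ?_⟩
  · have hstrong : IsStrongLocalMarkovTransform P Pα := by
      refine ⟨hmarkov, fun s t hst R hR => ?_⟩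
      rw [hlaw]
      exact tendsto_compose_of_tendsto_decayRate hP hstat hone (hKt hst) hst hα hR
    refine ⟨hstrong, fun hne Q hQ => hQ.1.unique hne hmarkov fun s t hst => ?_⟩
    -- Without a sequence of vanishing mesh the strong condition would be vacuous; along one,
    -- uniqueness of weak limits identifies the two-dimensional laws.
    obtain ⟨R, hR⟩ := exists_partition_tendsto_mesh hT hst
    exact tendsto_nhds_unique (hQ.2 s t hst R hR) (hstrong.2 s t hst R hR)
  · obtain ⟨δ, hδ, hδ0, hδα⟩ := exists_seq_tendsto_decayRate hα
    exact ⟨hmarkov, fun s t hst => ⟨fun n => gridPartition (hδ n) hst, hgrid δ hδ hδ0 hδα s t hst,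
      tendsto_mesh_gridPartition hT hst hδ hδ0⟩⟩
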